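/- Let $X$ be a reflexive complex Banach space and let $(T(t))_{t\ge 0}$ be a $C_0$ semigroup on $X$ with infinitesimal generator $A$. Suppose that there exists $t_0>0$ such that $AT(t_0)$ is bounded, i.e. $T(t_0)X\subseteq D(A)$ and $AT(t_0)$ is a bounded operator on $X$. Then for every $t>0$ $$\sigma_{ub}(T(t))\setminus\{0\}=\{e^{\lambda t}:\lambda\in\sigma_{ub}(A)\},$$ $$\sigma_{lb}(T(t))\setminus\{0\}=\{e^{\lambda t}:\lambda\in\sigma_{lb}(A)\},$$ $$\sigma_{b}(T(t))\setminus\{0\}=\{e^{\lambda t}:\lambda\in\sigma_{b}(A)\}.$$ Here a closed operator $B$ on $X$ is called upper semi-Browder if $\dim N(B)<\infty$, $R(B)$ is closed and $B$ has finite ascent $\inf\{n\in\mathbb{N}: N(B^n)=N(B^{n+1})\}$; lower semi-Browder if $\operatorname{codim} R(B)<\infty$ and $B$ has finite descent $\inf\{n\in\mathbb{N}: R(B^n)=R(B^{n+1})\}$ (with $\inf\emptyset=\infty$); and Browder if it is both. The sets $\sigma_{ub}(B)$, $\sigma_{lb}(B)$, $\sigma_b(B)$ consist of the $\lambda\in\mathbb{C}$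 for which $B-\lambda I$ is not upper semi-Browder, not lower semi-Browder, not Browder, respectively. -/

import Mathlib

open Filter Topology

namespace C0Spectra

variable {X : Type*} [NormedAddCommGroup X] [NormedSpace ℂ X]

/-- `X` is reflexive: the canonical embedding into the bidual is onto. -/
def IsReflexive (X : Type*) [NormedAddCommGroup X] [NormedSpace ℂ X] : Prop :=
  Function.Surjective (NormedSpace.inclusionInDoubleDual ℂ X)

/-- `(T(t))_{t ≥ 0}` is a `C₀` semigroup of bounded operators. Only the values of `T` on
`[0, ∞)` matter. -/
structure IsC0Semigroup (T : ℝ → X →L[ℂ] X) : Prop where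
  map_zero : T 0 = ContinuousLinearMap.id ℂ X
  map_add : ∀ t s : ℝ, 0 ≤ t → 0 ≤ s → T (t + s) = (T t).comp (T s)
  tendsto_zero : ∀ x : X, Tendsto (fun t : ℝ => T t x) (𝓝[>] 0) (𝓝 x)

/-- `y = lim_{t → 0+} (T(t) x - x) / t`. -/
def HasGeneratorValue (T : ℝ → X →L[ℂ] X) (x y : X) : Prop :=
  Tendsto (fun t : ℝ => ((t : ℂ)⁻¹) • (T t x - x)) (𝓝[>] 0) (𝓝 y)

theorem HasGeneratorValue.unique {T : ℝ → X →L[ℂ] X} {x y z : X}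
    (hy : HasGeneratorValue T x y) (hz : HasGeneratorValue T x z) : y = z :=
  tendsto_nhds_unique hy hz

theorem HasGeneratorValue.add {T : ℝ → X →L[ℂ] X} {x x' y y' : X}
    (h : HasGeneratorValue T x y) (h' : HasGeneratorValue T x' y') :
    HasGeneratorValue T (x + x') (y + y') := by
  refine (Tendsto.add h h').congr fun t => ?_
  rw [← smul_add, _root_.map_add]
  congr 1
  abel

theorem HasGeneratorValue.smul {T : ℝ → X →L[ℂ] X} {x y : X} (c : ℂ)
    (h : HasGeneratorValue T x y) : HasGeneratorValue T (c • x) (c • y) := by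
  refine (Tendsto.const_smul h c).congr fun t => ?_
  rw [smul_comm, map_smul, smul_sub]

theorem HasGeneratorValue.zero (T : ℝ → X →L[ℂ] X) : HasGeneratorValue T 0 0 := by
  simp [HasGeneratorValue]

/-- The infinitesimal generator `A x = lim_{t → 0+} (T(t) x - x) / t`, whose domain is the set
of all `x` for which the limit exists. -/
noncomputable def generator (T : ℝ → X →L[ℂ] X) : X →ₗ.[ℂ] X where
  domain :=
    { carrier := {x | ∃ y, HasGeneratorValue T x y}
      add_mem' := fun ⟨_, h⟩ ⟨_, h'⟩ => ⟨_, h.add h'⟩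
      zero_mem' := ⟨0, HasGeneratorValue.zero T⟩
      smul_mem' := fun c _ ⟨_, h⟩ => ⟨_, h.smul c⟩ }
  toFun :=
    { toFun := fun x => x.2.choose
      map_add' := fun x y =>
        (x + y).2.choose_spec.unique (x.2.choose_spec.add y.2.choose_spec)
      map_smul' := fun c x => (c • x).2.choose_spec.unique (x.2.choose_spec.smul c) }

/-- A bounded operator, seen as an operator with domain `X`. -/
def ofBounded (S : X →L[ℂ] X) : X →ₗ.[ℂ] X := (S : X →ₗ[ℂ] X).toPMap ⊤

/-- `A - z I`, with domain `D(A)`. -/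
def shift (A : X →ₗ.[ℂ] X) (z : ℂ) : X →ₗ.[ℂ] X where
  domain := A.domain
  toFun := A.toFun - z • A.domain.subtype

/-- The composition `B C` with its natural domain `{x ∈ D(C) | C x ∈ D(B)}`. -/
def compose (B C : X →ₗ.[ℂ] X) : X →ₗ.[ℂ] X where
  domain :=
    { carrier := {x | ∃ h : x ∈ C.domain, C ⟨x, h⟩ ∈ B.domain}
      add_mem' := fun {x y} ⟨hx, hx'⟩ ⟨hy, hy'⟩ => ⟨C.domain.add_mem hx hy, by
        have := C.map_add ⟨x, hx⟩ ⟨y, hy⟩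
        exact this ▸ B.domain.add_mem hx' hy'⟩
      zero_mem' := ⟨C.domain.zero_mem, by
        have h0 : C ⟨0, C.domain.zero_mem⟩ = 0 := C.map_zero
        rw [h0]
        exact B.domain.zero_mem⟩
      smul_mem' := fun c x ⟨hx, hx'⟩ => ⟨C.domain.smul_mem c hx, by
        have := C.map_smul c ⟨x, hx⟩
        exact this ▸ B.domain.smul_mem c hx'⟩ }
  toFun :=
    { toFun := fun x => B ⟨C ⟨x, x.2.fst⟩, x.2.snd⟩
      map_add' := fun x y => by
        rw [← LinearPMap.map_add]
        congr 1
        exact Subtype.ext (C.map_add ⟨x, x.2.fst⟩ ⟨y, y.2.fst⟩)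
      map_smul' := fun c x => by
        rw [RingHom.id_apply, ← LinearPMap.map_smul]
        congr 1
        exact Subtype.ext (C.map_smul c ⟨x, x.2.fst⟩) }

/-- The power `A ^ n` with its natural domain; `A ^ 0 = I` on all of `X`. -/
def power (A : X →ₗ.[ℂ] X) : ℕ → X →ₗ.[ℂ] X
  | 0 => ofBounded (ContinuousLinearMap.id ℂ X)
  | n + 1 => compose A (power A n)

/-- The null space `N(A) = {x ∈ D(A) | A x = 0}`. -/
def nullSpace (A : X →ₗ.[ℂ] X) : Submodule ℂ X :=
  (LinearMap.ker A.toFun).map A.domain.subtype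

/-- The range `R(A)`. -/
def range (A : X →ₗ.[ℂ] X) : Submodule ℂ X := LinearMap.range A.toFun

/-- `inf {n | N(A ^ n) = N(A ^ (n + 1))}`, with `inf ∅ = ∞`. -/
noncomputable def ascent (A : X →ₗ.[ℂ] X) : ℕ∞ :=
  sInf {k : ℕ∞ | ∃ n : ℕ, k = n ∧ nullSpace (power A n) = nullSpace (power A (n + 1))}

/-- `inf {n | R(A ^ n) = R(A ^ (n + 1))}`, with `inf ∅ = ∞`. -/
noncomputable def descent (A : X →ₗ.[ℂ] X) : ℕ∞ :=
  sInf {k : ℕ∞ | ∃ n : ℕ, k = n ∧ range (power A n) = range (power A (n + 1))}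

/-- For a closed operator `A`: `dim N(A) < ∞` and `R(A)` is closed. -/
def IsUpperSemiFredholm (A : X →ₗ.[ℂ] X) : Prop :=
  FiniteDimensional ℂ (nullSpace A) ∧ IsClosed (range A : Set X)

/-- For a closed operator `A`: `codim R(A) < ∞` (then `R(A)` is automatically closed when `X` is
a Banach space). -/
def IsLowerSemiFredholm (A : X →ₗ.[ℂ] X) : Prop :=
  FiniteDimensional ℂ (X ⧸ range A)

def IsUpperSemiBrowder (A : X →ₗ.[ℂ] X) : Prop :=
  IsUpperSemiFredholm A ∧ ascent A < ⊤

def IsLowerSemiBrowder (A : X →ₗ.[ℂ] X) : Prop :=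
  IsLowerSemiFredholm A ∧ descent A < ⊤

def IsBrowder (A : X →ₗ.[ℂ] X) : Prop :=
  IsLowerSemiBrowder A ∧ IsUpperSemiBrowder A

def upperSemiBrowderSpectrum (A : X →ₗ.[ℂ] X) : Set ℂ :=
  {z | ¬ IsUpperSemiBrowder (shift A z)}

def lowerSemiBrowderSpectrum (A : X →ₗ.[ℂ] X) : Set ℂ :=
  {z | ¬ IsLowerSemiBrowder (shift A z)}

def browderSpectrum (A : X →ₗ.[ℂ] X) : Set ℂ :=
  {z | ¬ IsBrowder (shift A z)}

end C0Spectra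

/-! The three Browder-type conditions share a multiplicative structure: invertible operators satisfy
them, and a product of two commuting bounded operators satisfies them exactly when both factors do
(`IsRegularity`). The spectral mapping theorem is proved once for every such property P.

To pass from the generator A to bounded operators, fix a resolvent R = (μ - A)⁻¹. Then A - z = Q_z
R⁻¹ with Q_z = (μ - z)R - 1, and Q_z y ∈ R(R) forces y ∈ R(R). Hence the powers of A - z and of Q_z
have the same null spaces and ranges (`IsQuotientOf.nullSpace_power`, `IsQuotientOf.range_power`),
and A - z is Browder in any of the three senses exactly when Q_z is.

Integrating the semigroup gives e^{-zt}T(t) - 1 = Q_z Y_z, where all operators commute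
(`IsResolvent.mul_cofactor`). So P for T(t) - e^{zt} passes to Q_z, which is one inclusion.

For the other, let ν ≠ 0 and work in the bicommutant of the semigroup, a commutative Banach algebra.
Boundedness of AT(t₀) makes a power of T(t) a multiple of R. A character φ with φ(T(t)) = ν thus has
φ(R) ≠ 0, with 1/φ(R) bounded independently of φ, and kills Q_z for z = μ - 1/φ(R). Then e^{zt} = ν,
so only finitely many z occur. The Q_z are pairwise coprime, and Y_z does not vanish where Q_z does,
because e^{(z-z')t} - 1 has a simple zero at z' = z. Therefore T(t) - ν is a unit times a finite
product of such Q_z (`exists_finset_factorization`), and P passes from the Q_z to T(t) - ν. -/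

namespace C0Spectra

/-! ### Bounded semi-Browder operators and regularities -/

section BoundedOperators

variable {X : Type*} [NormedAddCommGroup X] [NormedSpace ℂ X]

/-- A bounded operator with finite dimensional kernel, closed range and finite ascent. -/
def UpperBrowder (a : X →L[ℂ] X) : Prop :=
  (FiniteDimensional ℂ a.ker ∧ IsClosed (a.range : Set X)) ∧
    ∃ n : ℕ, (a ^ n).ker = (a ^ (n + 1)).ker

/-- A bounded operator with range of finite codimension and finite descent. -/
def LowerBrowder (a : X →L[ℂ] X) : Prop :=
  FiniteDimensional ℂ (X ⧸ a.range) ∧ ∃ n : ℕ, (a ^ n).range = (a ^ (n + 1)).range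

theorem finiteDimensional_ker_mul {a b : X →L[ℂ] X} (ha : FiniteDimensional ℂ a.ker)
    (hb : FiniteDimensional ℂ b.ker) : FiniteDimensional ℂ (a * b).ker := by
  have h : (a * b).ker = a.ker.comap (b : X →ₗ[ℂ] X) := by ext x; simp
  rw [h]
  infer_instance

theorem finiteDimensional_ker_pow {a : X →L[ℂ] X} (ha : FiniteDimensional ℂ a.ker) (n : ℕ) :
    FiniteDimensional ℂ (a ^ n).ker := by
  induction n with
  | zero =>
    have h : (a ^ 0).ker = ⊥ := by ext x; simp
    rw [h]
    infer_instance
  | succ n ih =>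
    rw [pow_succ]
    exact finiteDimensional_ker_mul ih ha

theorem finiteDimensional_quotient_range_mul {a b : X →L[ℂ] X}
    (ha : FiniteDimensional ℂ (X ⧸ a.range)) (hb : FiniteDimensional ℂ (X ⧸ b.range)) :
    FiniteDimensional ℂ (X ⧸ (a * b).range) := by
  have h : (a * b).range = b.range.map (a : X →ₗ[ℂ] X) := by ext x; simp
  rw [h]
  infer_instance

theorem finiteDimensional_quotient_range_pow {a : X →L[ℂ] X}
    (ha : FiniteDimensional ℂ (X ⧸ a.range)) (n : ℕ) :
    FiniteDimensional ℂ (X ⧸ (a ^ n).range) := by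
  induction n with
  | zero =>
    have h : (a ^ 0).range = ⊤ := by ext x; simp
    rw [h]
    infer_instance
  | succ n ih =>
    rw [pow_succ]
    exact finiteDimensional_quotient_range_mul ih ha

theorem ker_le_ker_mul (a b : X →L[ℂ] X) : b.ker ≤ (a * b).ker := by
  intro x hx
  have hx' : b x = 0 := by simpa using hx
  simp [hx']

theorem range_mul_le_range (a b : X →L[ℂ] X) : (a * b).range ≤ a.range := by
  rintro _ ⟨x, rfl⟩
  exact ⟨b x, rfl⟩

theorem ker_pow_mono (a : X →L[ℂ] X) : Monotone fun n : ℕ => (a ^ n).ker :=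
  monotone_nat_of_le_succ fun n => by
    simp only [pow_succ' a n]
    exact ker_le_ker_mul _ _

theorem range_pow_anti (a : X →L[ℂ] X) : Antitone fun n : ℕ => (a ^ n).range :=
  antitone_nat_of_succ_le fun n => by
    simp only [pow_succ a n]
    exact range_mul_le_range _ _

theorem ker_pow_stable {a : X →L[ℂ] X} {n : ℕ} (h : (a ^ n).ker = (a ^ (n + 1)).ker) (k : ℕ) :
    (a ^ (n + k)).ker = (a ^ n).ker := by
  induction k with
  | zero => rfl
  | succ k ih =>
    refine le_antisymm (fun x hx => ?_) (ker_pow_mono a (by omega))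
    have h1 : a x ∈ (a ^ (n + k)).ker := by
      have : (a ^ (n + k + 1)) x = 0 := hx
      rw [pow_succ] at this
      exact this
    rw [ih] at h1
    rw [h, pow_succ]
    exact h1

theorem range_pow_stable {a : X →L[ℂ] X} {n : ℕ} (h : (a ^ n).range = (a ^ (n + 1)).range)
    (k : ℕ) : (a ^ (n + k)).range = (a ^ n).range := by
  induction k with
  | zero => rfl
  | succ k ih =>
    refine le_antisymm (range_pow_anti a (by omega)) ?_
    rw [h]
    rintro _ ⟨x, rfl⟩
    have h1 : (a ^ n) x ∈ (a ^ (n + k)).range := ih ▸ ⟨x, rfl⟩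
    obtain ⟨y, hy⟩ := h1
    refine ⟨y, ?_⟩
    have hy' : (a ^ (n + k)) y = (a ^ n) x := hy
    change (a ^ (n + k + 1)) y = (a ^ (n + 1)) x
    rw [pow_succ' a (n + k), pow_succ' a n]
    simp [hy']

/-- A bounded operator has finite dimensional kernel and closed range exactly when it becomes
bounded below after adjoining finitely many functionals. -/
theorem exists_antilipschitz_prod [CompleteSpace X] {a : X →L[ℂ] X}
    (hk : FiniteDimensional ℂ a.ker) (hr : IsClosed (a.range : Set X)) :
    ∃ (p : X →L[ℂ] a.ker) (K : NNReal), AntilipschitzWith K (a.prod p) := by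
  obtain ⟨p, hp⟩ := Submodule.ClosedComplemented.of_finiteDimensional a.ker
  refine ⟨p, ?_⟩
  have hinj : Function.Injective (a.prod p) := by
    rw [injective_iff_map_eq_zero]
    intro x hx
    have h1 : a x = 0 := congrArg Prod.fst hx
    have h2 : p x = 0 := congrArg Prod.snd hx
    have h3 := hp ⟨x, h1⟩
    rw [h2] at h3
    exact (congrArg Subtype.val h3).symm
  refine (a.prod p).antilipschitz_of_injective_of_isClosed_range hinj ?_
  have hrange : Set.range (a.prod p) = (a.range : Set X) ×ˢ Set.univ := by
    ext ⟨y, n⟩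
    constructor
    · rintro ⟨x, hx⟩
      exact ⟨⟨x, congrArg Prod.fst hx⟩, trivial⟩
    · rintro ⟨⟨x, hx⟩, -⟩
      -- As `p` projects onto the kernel of `a`, subtracting `p x` keeps the image under `a` and
      -- clears the second coordinate.
      refine ⟨x - p x + n, ?_⟩
      have hx' : a x = y := hx
      have h1 : ∀ m : a.ker, a (m : X) = 0 := fun m => m.2
      ext1
      · simp [h1, hx']
      · simp [hp]
  rw [hrange]
  exact hr.prod isClosed_univ

theorem finiteDimensional_ker_of_antilipschitz_prod {E : Type*} [NormedAddCommGroup E]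
    [NormedSpace ℂ E] [FiniteDimensional ℂ E] {a : X →L[ℂ] X} {p : X →L[ℂ] E} {K : NNReal}
    (h : AntilipschitzWith K (a.prod p)) : FiniteDimensional ℂ a.ker := by
  refine Module.Finite.of_injective ((p : X →ₗ[ℂ] E).comp a.ker.subtype) ?_
  intro x y hxy
  refine Subtype.ext (h.injective (Prod.ext ?_ hxy))
  have hx : a (x : X) = 0 := x.2
  have hy : a (y : X) = 0 := y.2
  change a x = a y
  rw [hx, hy]

/-- On the kernel of `p`, which has finite codimension, `a` alone is bounded below, so it maps that
kernel onto a closed subspace; the full range exceeds it by finitely many dimensions. -/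
theorem isClosed_range_of_antilipschitz_prod [CompleteSpace X] {E : Type*} [NormedAddCommGroup E]
    [NormedSpace ℂ E] [FiniteDimensional ℂ E] {a : X →L[ℂ] X} {p : X →L[ℂ] E} {K : NNReal}
    (h : AntilipschitzWith K (a.prod p)) : IsClosed (a.range : Set X) := by
  have hq : FiniteDimensional ℂ (X ⧸ p.ker) :=
    Module.Finite.equiv (LinearMap.quotKerEquivRange (p : X →ₗ[ℂ] E)).symm
  have hcl : IsClosed (p.ker : Set X) := p.isClosed_ker
  have : CompleteSpace p.ker := hcl.completeSpace_coe
  refine LinearMap.isClosed_range_of_isClosed_map_of_finiteDimensional_quotient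
    (s := p.ker) (f := (a : X →ₗ[ℂ] X)) ?_
  have ha : AntilipschitzWith K (a.comp p.ker.subtypeL) := by
    refine AntilipschitzWith.of_le_mul_dist fun x y => ?_
    refine (h.le_mul_dist (x : X) y).trans_eq ?_
    have hx : p (x : X) = 0 := x.2
    have hy : p (y : X) = 0 := y.2
    simp [Prod.dist_eq, hx, hy]
  have hc := ha.isClosed_range (a.comp p.ker.subtypeL).uniformContinuous
  convert hc using 1
  ext y
  simp

/-- The pair (b x, q x) controls x, and (a b x, p b x) controls b x. -/
theorem exists_antilipschitz_prod_mul {E F : Type*} [NormedAddCommGroup E] [NormedSpace ℂ E]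
    [NormedAddCommGroup F] [NormedSpace ℂ F] {a b : X →L[ℂ] X} {p : X →L[ℂ] E} {q : X →L[ℂ] F}
    {K K' : NNReal} (ha : AntilipschitzWith K (a.prod p)) (hb : AntilipschitzWith K' (b.prod q)) :
    ∃ K'' : NNReal, AntilipschitzWith K'' ((a * b).prod ((p.comp b).prod q)) := by
  refine ⟨K' * max K 1, AntilipschitzWith.of_le_mul_dist fun x y => ?_⟩
  refine (hb.le_mul_dist x y).trans ?_
  rw [NNReal.coe_mul, mul_assoc]
  refine mul_le_mul_of_nonneg_left ?_ K'.2
  have h1 := ha.le_mul_dist (b x) (b y)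
  simp only [ContinuousLinearMap.prod_apply, Prod.dist_eq,
    ContinuousLinearMap.comp_apply, NNReal.coe_max, NNReal.coe_one] at h1 ⊢
  refine max_le (h1.trans ?_) ?_
  · refine mul_le_mul (le_max_left _ _) ?_ (by positivity) (by positivity)
    exact max_le_max le_rfl (le_max_left _ _)
  · calc dist (q x) (q y) = 1 * dist (q x) (q y) := (one_mul _).symm
      _ ≤ _ := mul_le_mul (le_max_right _ _)
        (le_max_of_le_right (le_max_right _ _)) dist_nonneg (by positivity)

theorem antilipschitz_prod_of_mul {E : Type*} [NormedAddCommGroup E] [NormedSpace ℂ E]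
    {a b : X →L[ℂ] X} {p : X →L[ℂ] E} {K : NNReal}
    (h : AntilipschitzWith K ((b * a).prod p)) :
    ∃ K' : NNReal, AntilipschitzWith K' (a.prod p) := by
  refine ⟨K * max ‖b‖₊ 1, AntilipschitzWith.of_le_mul_dist fun x y => ?_⟩
  refine (h.le_mul_dist x y).trans ?_
  rw [NNReal.coe_mul, mul_assoc]
  refine mul_le_mul_of_nonneg_left ?_ K.2
  have h1 := b.lipschitz.dist_le_mul (a x) (a y)
  simp only [ContinuousLinearMap.prod_apply, Prod.dist_eq,
    NNReal.coe_max, NNReal.coe_one] at h1 ⊢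
  refine max_le (h1.trans ?_) ?_
  · exact mul_le_mul (le_max_left _ _) (le_max_left _ _) dist_nonneg (by positivity)
  · calc dist (p x) (p y) = 1 * dist (p x) (p y) := (one_mul _).symm
      _ ≤ _ := mul_le_mul (le_max_right _ _) (le_max_right _ _) dist_nonneg (by positivity)

/-- Closedness of the range comes from composing lower bounds. For the ascent, both kernel chains
are constant from m + n on, so commutation allows lowering the exponent of one factor at a time. -/
theorem UpperBrowder.mul [CompleteSpace X] {a b : X →L[ℂ] X} (hab : Commute a b)
    (ha : UpperBrowder a) (hb : UpperBrowder b) : UpperBrowder (a * b) := by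
  obtain ⟨⟨ha1, ha2⟩, m, hm⟩ := ha
  obtain ⟨⟨hb1, hb2⟩, n, hn⟩ := hb
  obtain ⟨p, K, hp⟩ := exists_antilipschitz_prod ha1 ha2
  obtain ⟨q, K', hq⟩ := exists_antilipschitz_prod hb1 hb2
  obtain ⟨K'', h⟩ := exists_antilipschitz_prod_mul hp hq
  refine ⟨⟨finiteDimensional_ker_of_antilipschitz_prod h,
    isClosed_range_of_antilipschitz_prod h⟩, m + n, ?_⟩
  refine le_antisymm (ker_pow_mono _ (Nat.le_succ _)) fun x hx => ?_
  have h0 : (a ^ (m + n + 1)) ((b ^ (m + n + 1)) x) = 0 := by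
    have : ((a * b) ^ (m + n + 1)) x = 0 := hx
    rw [hab.mul_pow] at this
    exact this
  have h1 : (b ^ (m + n + 1)) x ∈ (a ^ (m + n)).ker := by
    rw [ker_pow_stable hm, ← ker_pow_stable hm (n + 1), ← add_assoc]
    exact h0
  have h2 : (a ^ (m + n)) x ∈ (b ^ (m + n)).ker := by
    rw [add_comm m n, ker_pow_stable hn, ← ker_pow_stable hn (m + 1), ← add_assoc]
    have h3 : (a ^ (m + n)) ((b ^ (m + n + 1)) x) = 0 := h1
    have h4 : (a ^ (m + n)) ((b ^ (m + n + 1)) x) = (b ^ (m + n + 1)) ((a ^ (m + n)) x) :=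
      congrArg (fun f : X →L[ℂ] X => f x) (hab.pow_pow (m + n) (m + n + 1)).eq
    rw [h4] at h3
    rw [add_comm n m]
    exact h3
  have h3 : (b ^ (m + n)) ((a ^ (m + n)) x) = 0 := h2
  change ((a * b) ^ (m + n)) x = 0
  rw [hab.mul_pow, (hab.pow_pow (m + n) (m + n)).eq]
  exact h3

/-- A lower bound for ba with extra functionals gives one for a with the same functionals. The
kernels of all powers of a lie in the finite dimensional space N((ab)ⁿ), so their increasing chain
stabilizes. -/
theorem UpperBrowder.of_mul [CompleteSpace X] {a b : X →L[ℂ] X} (hab : Commute a b)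
    (h : UpperBrowder (a * b)) : UpperBrowder a := by
  obtain ⟨⟨h1, h2⟩, n, hn⟩ := h
  obtain ⟨p, K, hp⟩ := exists_antilipschitz_prod h1 h2
  have hp' : AntilipschitzWith K ((b * a).prod p) := by rwa [← hab.eq]
  obtain ⟨K', hK'⟩ := antilipschitz_prod_of_mul hp'
  refine ⟨⟨finiteDimensional_ker_of_antilipschitz_prod hK',
    isClosed_range_of_antilipschitz_prod hK'⟩, ?_⟩
  have hle : ∀ k, (a ^ k).ker ≤ ((a * b) ^ n).ker := fun k =>
    calc (a ^ k).ker ≤ (b ^ k * a ^ k).ker := ker_le_ker_mul _ _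
      _ = ((a * b) ^ k).ker := by rw [hab.mul_pow, (hab.pow_pow k k).eq]
      _ ≤ ((a * b) ^ (n + k)).ker := ker_pow_mono _ (Nat.le_add_left k n)
      _ = _ := ker_pow_stable hn k
  have hfd : FiniteDimensional ℂ ((a * b) ^ n).ker := finiteDimensional_ker_pow h1 n
  obtain ⟨k, hk⟩ := monotone_stabilizes_iff_noetherian.mpr
    (inferInstance : IsNoetherian ℂ ((a * b) ^ n).ker)
    ⟨fun k => (a ^ k).ker.submoduleOf ((a * b) ^ n).ker,
      fun i j hij => Submodule.comap_mono (ker_pow_mono a hij)⟩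
  refine ⟨k, ?_⟩
  have hk' := hk (k + 1) (Nat.le_succ k)
  change Submodule.comap _ _ = Submodule.comap _ _ at hk'
  have h3 := congrArg (Submodule.map ((a * b) ^ n).ker.subtype) hk'
  rwa [Submodule.map_comap_subtype, Submodule.map_comap_subtype, inf_eq_right.2 (hle _),
    inf_eq_right.2 (hle _)] at h3

theorem LowerBrowder.mul {a b : X →L[ℂ] X} (hab : Commute a b)
    (ha : LowerBrowder a) (hb : LowerBrowder b) : LowerBrowder (a * b) := by
  obtain ⟨ha1, m, hm⟩ := ha
  obtain ⟨hb1, n, hn⟩ := hb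
  refine ⟨finiteDimensional_quotient_range_mul ha1 hb1, m + n, ?_⟩
  refine le_antisymm ?_ (range_pow_anti _ (Nat.le_succ _))
  rintro _ ⟨x, rfl⟩
  have h1 : (b ^ (m + n)) x ∈ (b ^ (m + n + 1)).range := by
    have : (b ^ (m + n)).range = (b ^ (m + n + 1)).range := by
      rw [add_comm m n, add_assoc, range_pow_stable hn, range_pow_stable hn]
    exact this ▸ ⟨x, rfl⟩
  obtain ⟨y, hy⟩ := h1
  have h2 : (a ^ (m + n)) y ∈ (a ^ (m + n + 1)).range := by
    have : (a ^ (m + n)).range = (a ^ (m + n + 1)).range := by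
      rw [add_assoc, range_pow_stable hm, range_pow_stable hm]
    exact this ▸ ⟨y, rfl⟩
  obtain ⟨z, hz⟩ := h2
  have hy' : (b ^ (m + n + 1)) y = (b ^ (m + n)) x := hy
  have hz' : (a ^ (m + n + 1)) z = (a ^ (m + n)) y := hz
  refine ⟨z, ?_⟩
  change ((a * b) ^ (m + n + 1)) z = ((a * b) ^ (m + n)) x
  have h4 : (a ^ (m + n)) ((b ^ (m + n + 1)) y) = (b ^ (m + n + 1)) ((a ^ (m + n)) y) :=
    congrArg (fun f : X →L[ℂ] X => f y) (hab.pow_pow (m + n) (m + n + 1)).eq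
  rw [hab.mul_pow, hab.mul_pow, (hab.pow_pow (m + n + 1) (m + n + 1)).eq]
  change (b ^ (m + n + 1)) ((a ^ (m + n + 1)) z) = (a ^ (m + n)) ((b ^ (m + n)) x)
  rw [hz', ← hy', h4]

/-- The ranges of all powers of a contain R((ab)ⁿ), which has finite codimension, so their
decreasing chain stabilizes in the quotient. -/
theorem LowerBrowder.of_mul {a b : X →L[ℂ] X} (hab : Commute a b)
    (h : LowerBrowder (a * b)) : LowerBrowder a := by
  obtain ⟨h1, n, hn⟩ := h
  refine ⟨Submodule.CoFG.of_le (range_mul_le_range a b) h1, ?_⟩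
  have hle : ∀ k, ((a * b) ^ n).range ≤ (a ^ k).range := fun k =>
    calc ((a * b) ^ n).range = ((a * b) ^ (n + k)).range := (range_pow_stable hn k).symm
      _ ≤ ((a * b) ^ k).range := range_pow_anti _ (Nat.le_add_left k n)
      _ = (a ^ k * b ^ k).range := by rw [hab.mul_pow]
      _ ≤ (a ^ k).range := range_mul_le_range _ _
  have hfd : FiniteDimensional ℂ (X ⧸ ((a * b) ^ n).range) :=
    finiteDimensional_quotient_range_pow h1 n
  obtain ⟨k, hk⟩ := IsArtinian.monotone_stabilizes (R := ℂ) (M := X ⧸ ((a * b) ^ n).range)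
    ⟨fun k => OrderDual.toDual ((a ^ k).range.map ((a * b) ^ n).range.mkQ),
      fun i j hij => Submodule.map_mono (range_pow_anti a hij)⟩
  refine ⟨k, ?_⟩
  have hk' := hk (k + 1) (Nat.le_succ k)
  change Submodule.map _ _ = Submodule.map _ _ at hk'
  have h3 := congrArg (Submodule.comap ((a * b) ^ n).range.mkQ) hk'
  rwa [Submodule.comap_map_mkQ, Submodule.comap_map_mkQ, sup_eq_right.2 (hle _),
    sup_eq_right.2 (hle _)] at h3

theorem UpperBrowder.of_isUnit [CompleteSpace X] {a : X →L[ℂ] X} (ha : IsUnit a) :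
    UpperBrowder a := by
  have hone : UpperBrowder (1 : X →L[ℂ] X) := by
    refine ⟨⟨?_, ?_⟩, 0, by simp⟩
    · have h : (1 : X →L[ℂ] X).ker = ⊥ := by ext x; simp
      rw [h]
      infer_instance
    · have h : (1 : X →L[ℂ] X).range = ⊤ := by ext x; simp
      rw [h]
      exact isClosed_univ
  obtain ⟨u, rfl⟩ := ha
  refine UpperBrowder.of_mul (b := ↑u⁻¹) (by simp [Commute, SemiconjBy]) ?_
  rwa [Units.mul_inv]

theorem LowerBrowder.of_isUnit {a : X →L[ℂ] X} (ha : IsUnit a) : LowerBrowder a := by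
  have hone : LowerBrowder (1 : X →L[ℂ] X) := by
    refine ⟨?_, 0, by simp⟩
    have h : (1 : X →L[ℂ] X).range = ⊤ := by ext x; simp
    rw [h]
    infer_instance
  obtain ⟨u, rfl⟩ := ha
  refine LowerBrowder.of_mul (b := ↑u⁻¹) (by simp [Commute, SemiconjBy]) ?_
  rwa [Units.mul_inv]

/-- Properties of bounded operators that hold for invertible operators and that a product of two
commuting operators has precisely when both factors have it. -/
structure IsRegularity (P : (X →L[ℂ] X) → Prop) : Prop where
  of_isUnit : ∀ a, IsUnit a → P a
  mul : ∀ a b, Commute a b → P a → P b → P (a * b)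
  of_mul : ∀ a b, Commute a b → P (a * b) → P a

theorem isRegularity_upperBrowder [CompleteSpace X] :
    IsRegularity (UpperBrowder : (X →L[ℂ] X) → Prop) :=
  ⟨fun _ => UpperBrowder.of_isUnit, fun _ _ => UpperBrowder.mul, fun _ _ => UpperBrowder.of_mul⟩

theorem isRegularity_lowerBrowder :
    IsRegularity (LowerBrowder : (X →L[ℂ] X) → Prop) :=
  ⟨fun _ => LowerBrowder.of_isUnit, fun _ _ => LowerBrowder.mul, fun _ _ => LowerBrowder.of_mul⟩

theorem IsRegularity.and {P P' : (X →L[ℂ] X) → Prop} (h : IsRegularity P)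
    (h' : IsRegularity P') : IsRegularity fun a => P a ∧ P' a :=
  ⟨fun a ha => ⟨h.of_isUnit a ha, h'.of_isUnit a ha⟩,
    fun a b hab ha hb => ⟨h.mul a b hab ha.1 hb.1, h'.mul a b hab ha.2 hb.2⟩,
    fun a b hab hh => ⟨h.of_mul a b hab hh.1, h'.of_mul a b hab hh.2⟩⟩

end BoundedOperators

/-! ### Unbounded operators as quotients of commuting bounded ones -/

section UnboundedOperators

variable {X : Type*} [NormedAddCommGroup X] [NormedSpace ℂ X]

/-- `L = Q R⁻¹` for commuting bounded operators `R`, `Q`, where `R` is injective and `Q` is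
injective modulo `R(R)`. -/
structure IsQuotientOf (L : X →ₗ.[ℂ] X) (Q R : X →L[ℂ] X) : Prop where
  injective : Function.Injective R
  commute : Commute Q R
  domain_eq : L.domain = R.range
  apply_eq : ∀ y (h : R y ∈ L.domain), L ⟨R y, h⟩ = Q y
  mem_range_of_apply : ∀ y, Q y ∈ R.range → y ∈ R.range

namespace IsQuotientOf

variable {L : X →ₗ.[ℂ] X} {Q R : X →L[ℂ] X}

theorem mem_range_of_pow_apply (h : IsQuotientOf L Q R) (n : ℕ) {y : X}
    (hy : (Q ^ n) y ∈ R.range) : y ∈ R.range := by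
  induction n generalizing y with
  | zero => exact hy
  | succ n ih =>
    rw [pow_succ] at hy
    exact h.mem_range_of_apply y (ih hy)

/-- Applying L once more to Lⁿ Rⁿ y = Qⁿ y requires Qⁿ y ∈ R(R), which forces y ∈ R(R); the domains
of the powers therefore shrink exactly like R(Rⁿ). -/
theorem power_domain_apply (h : IsQuotientOf L Q R) (n : ℕ) :
    (power L n).domain = (R ^ n).range ∧
      ∀ y (hy : (R ^ n) y ∈ (power L n).domain), power L n ⟨(R ^ n) y, hy⟩ = (Q ^ n) y := by
  induction n with
  | zero =>
    refine ⟨?_, fun y hy => rfl⟩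
    ext x
    simp [power, ofBounded]
  | succ n ih =>
    obtain ⟨hd, ha⟩ := ih
    have hcomm : ∀ y, (Q ^ n) (R y) = R ((Q ^ n) y) := fun y =>
      congrArg (fun f : X →L[ℂ] X => f y) (h.commute.pow_left n).eq
    have happ : ∀ y, (R ^ (n + 1)) y = (R ^ n) (R y) := fun y => by
      rw [pow_succ]
      rfl
    have hQ : ∀ y, (Q ^ (n + 1)) y = Q ((Q ^ n) y) := fun y => by
      rw [pow_succ']
      rfl
    refine ⟨?_, ?_⟩
    · ext x
      constructor
      · rintro ⟨hx, hx'⟩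
        have hx2 := hx
        rw [hd] at hx2
        obtain ⟨y, rfl⟩ := hx2
        have hx3 : power L n ⟨(R ^ n) y, hx⟩ ∈ L.domain := hx'
        rw [ha y hx, h.domain_eq] at hx3
        obtain ⟨z, rfl⟩ := h.mem_range_of_pow_apply n hx3
        exact ⟨z, happ z⟩
      · rintro ⟨y, rfl⟩
        have hx : (R ^ n) (R y) ∈ (power L n).domain := hd ▸ ⟨R y, rfl⟩
        change (R ^ (n + 1)) y ∈ (compose L (power L n)).domain
        rw [happ]
        refine ⟨hx, ?_⟩
        rw [ha _ hx, hcomm, h.domain_eq]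
        exact ⟨_, rfl⟩
    · intro y hy
      have hx : (R ^ n) (R y) ∈ (power L n).domain := hd ▸ ⟨R y, rfl⟩
      have hv : power L n ⟨(R ^ n) (R y), hx⟩ = R ((Q ^ n) y) := by rw [ha _ hx, hcomm]
      have hv' : R ((Q ^ n) y) ∈ L.domain := by
        rw [h.domain_eq]
        exact ⟨_, rfl⟩
      rw [hQ, ← h.apply_eq _ hv']
      refine congrArg L (Subtype.ext ?_)
      refine Eq.trans ?_ hv
      exact congrArg (power L n) (Subtype.ext (happ y))

/-- Since 0 ∈ R(R), y = R z; injectivity of R gives Qⁿ z = 0, and the argument repeats with z. This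
places N(Qⁿ) inside the domain of Lⁿ. -/
theorem mem_range_pow_of_pow_apply_eq_zero (h : IsQuotientOf L Q R) (n k : ℕ) {y : X}
    (hy : (Q ^ n) y = 0) : y ∈ (R ^ k).range := by
  induction k generalizing y with
  | zero => exact ⟨y, rfl⟩
  | succ k ih =>
    obtain ⟨z, rfl⟩ := h.mem_range_of_pow_apply n (y := y) (hy ▸ Submodule.zero_mem _)
    have hcomm : (Q ^ n) (R z) = R ((Q ^ n) z) :=
      congrArg (fun f : X →L[ℂ] X => f z) (h.commute.pow_left n).eq
    have hz : (Q ^ n) z = 0 := by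
      refine h.injective ?_
      rw [_root_.map_zero, ← hcomm]
      exact hy
    obtain ⟨w, hw⟩ := ih hz
    have hw' : (R ^ k) w = z := hw
    refine ⟨w, ?_⟩
    change (R ^ (k + 1)) w = R z
    rw [pow_succ', ← hw']
    rfl

theorem mem_nullSpace_iff {B : X →ₗ.[ℂ] X} {x : X} :
    x ∈ nullSpace B ↔ ∃ hx : x ∈ B.domain, B ⟨x, hx⟩ = 0 := by
  constructor
  · rintro ⟨y, hy, rfl⟩
    exact ⟨y.2, hy⟩
  · rintro ⟨hx, h0⟩
    exact ⟨⟨x, hx⟩, h0, rfl⟩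

theorem nullSpace_power (h : IsQuotientOf L Q R) (n : ℕ) :
    nullSpace (power L n) = (Q ^ n).ker := by
  obtain ⟨hd, ha⟩ := h.power_domain_apply n
  have hcomm : ∀ y, (Q ^ n) ((R ^ n) y) = (R ^ n) ((Q ^ n) y) := fun y =>
    congrArg (fun f : X →L[ℂ] X => f y) (h.commute.pow_pow n n).eq
  have hinj : Function.Injective (R ^ n) := by
    rw [FunLike.coe_pow_eq_iterate]
    exact h.injective.iterate n
  ext x
  rw [mem_nullSpace_iff]
  constructor
  · rintro ⟨hx, h0⟩
    have hx2 := hx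
    rw [hd] at hx2
    obtain ⟨y, rfl⟩ := hx2
    have h1 : (Q ^ n) y = 0 := (ha y hx).symm.trans h0
    change (Q ^ n) ((R ^ n) y) = 0
    rw [hcomm, h1, _root_.map_zero]
  · intro hx
    have hx0 : (Q ^ n) x = 0 := hx
    obtain ⟨y, rfl⟩ := h.mem_range_pow_of_pow_apply_eq_zero n n hx0
    have hy : (R ^ n) y ∈ (power L n).domain := hd ▸ ⟨y, rfl⟩
    refine ⟨hy, (ha y hy).trans (hinj ?_)⟩
    rw [_root_.map_zero, ← hcomm]
    exact hx0

theorem range_power (h : IsQuotientOf L Q R) (n : ℕ) : range (power L n) = (Q ^ n).range := by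
  obtain ⟨hd, ha⟩ := h.power_domain_apply n
  ext x
  constructor
  · rintro ⟨⟨w, hw⟩, rfl⟩
    have hw2 := hw
    rw [hd] at hw2
    obtain ⟨y, rfl⟩ := hw2
    exact ⟨y, (ha y hw).symm⟩
  · rintro ⟨y, rfl⟩
    have hy : (R ^ n) y ∈ (power L n).domain := hd ▸ ⟨y, rfl⟩
    exact ⟨⟨_, hy⟩, ha y hy⟩

theorem nullSpace_power_one_and_range_power_one (B : X →ₗ.[ℂ] X) :
    nullSpace (power B 1) = nullSpace B ∧ range (power B 1) = range B := by
  have hmem : ∀ x, x ∈ (power B 1).domain ↔ x ∈ B.domain :=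
    fun x => ⟨fun h => h.2, fun h => ⟨trivial, h⟩⟩
  constructor
  · ext x
    rw [mem_nullSpace_iff, mem_nullSpace_iff]
    exact ⟨fun ⟨hx, h0⟩ => ⟨(hmem x).1 hx, h0⟩, fun ⟨hx, h0⟩ => ⟨(hmem x).2 hx, h0⟩⟩
  · ext x
    exact ⟨fun ⟨⟨w, hw⟩, h0⟩ => ⟨⟨w, (hmem w).1 hw⟩, h0⟩,
      fun ⟨⟨w, hw⟩, h0⟩ => ⟨⟨w, (hmem w).2 hw⟩, h0⟩⟩

theorem nullSpace_eq (h : IsQuotientOf L Q R) : nullSpace L = Q.ker := by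
  rw [← (nullSpace_power_one_and_range_power_one L).1, h.nullSpace_power, pow_one]

theorem range_eq (h : IsQuotientOf L Q R) : range L = Q.range := by
  rw [← (nullSpace_power_one_and_range_power_one L).2, h.range_power, pow_one]

theorem sInf_coe_lt_top_iff (p : ℕ → Prop) :
    sInf {k : ℕ∞ | ∃ n : ℕ, k = n ∧ p n} < ⊤ ↔ ∃ n, p n := by
  rw [sInf_lt_iff]
  exact ⟨fun ⟨_, ⟨n, _, hn⟩, _⟩ => ⟨n, hn⟩, fun ⟨n, hn⟩ => ⟨n, ⟨n, rfl, hn⟩, ENat.natCast_lt_top n⟩⟩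

theorem isUpperSemiBrowder_iff (h : IsQuotientOf L Q R) :
    IsUpperSemiBrowder L ↔ UpperBrowder Q := by
  simp only [IsUpperSemiBrowder, IsUpperSemiFredholm, UpperBrowder, ascent, sInf_coe_lt_top_iff,
    h.nullSpace_power, h.range_eq]
  rw [h.nullSpace_eq]

theorem isLowerSemiBrowder_iff (h : IsQuotientOf L Q R) :
    IsLowerSemiBrowder L ↔ LowerBrowder Q := by
  simp only [IsLowerSemiBrowder, IsLowerSemiFredholm, LowerBrowder, descent, sInf_coe_lt_top_iff,
    h.range_power]
  rw [h.range_eq]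

theorem isBrowder_iff (h : IsQuotientOf L Q R) :
    IsBrowder L ↔ LowerBrowder Q ∧ UpperBrowder Q := by
  rw [IsBrowder, h.isLowerSemiBrowder_iff, h.isUpperSemiBrowder_iff]

theorem ofBounded_shift (S : X →L[ℂ] X) (z : ℂ) :
    IsQuotientOf (shift (ofBounded S) z) (S - z • (1 : X →L[ℂ] X)) 1 where
  injective := Function.injective_id
  commute := Commute.one_right _
  domain_eq := by
    ext x
    simp [shift, ofBounded]
  apply_eq _ _ := rfl
  mem_range_of_apply y _ := ⟨y, rfl⟩

end IsQuotientOf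

end UnboundedOperators

/-! ### C₀ semigroups: local boundedness, continuity, integrals, rescaling -/

section Semigroups

variable {X : Type*} [NormedAddCommGroup X] [NormedSpace ℂ X] {T : ℝ → X →L[ℂ] X}

namespace IsC0Semigroup

theorem commute (hT : IsC0Semigroup T) {s t : ℝ} (hs : 0 ≤ s) (ht : 0 ≤ t) :
    Commute (T s) (T t) := by
  change (T s).comp (T t) = (T t).comp (T s)
  rw [← hT.map_add s t hs ht, ← hT.map_add t s ht hs, add_comm]

theorem apply_add (hT : IsC0Semigroup T) {s t : ℝ} (hs : 0 ≤ s) (ht : 0 ≤ t) (x : X) :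
    T (s + t) x = T s (T t x) := by
  rw [hT.map_add s t hs ht]
  rfl

theorem apply_zero (hT : IsC0Semigroup T) (x : X) : T 0 x = x := by
  rw [hT.map_zero]
  rfl

/-- The semigroup `e^{-z s} T(s)`. -/
theorem rescale (hT : IsC0Semigroup T) (z : ℂ) :
    IsC0Semigroup fun s : ℝ => Complex.exp (-z * s) • T s where
  map_zero := by simp [hT.map_zero]
  map_add s t hs ht := by
    ext x
    simp only [Complex.ofReal_add, mul_add, Complex.exp_add, _root_.smul_apply,
      ContinuousLinearMap.comp_apply, _root_.map_smul, hT.apply_add hs ht, mul_smul]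
    exact smul_comm _ _ _
  tendsto_zero x := by
    have h1 : Tendsto (fun s : ℝ => Complex.exp (-z * s)) (𝓝[>] 0) (𝓝 1) := by
      have h : Continuous fun s : ℝ => Complex.exp (-z * s) := by fun_prop
      have := h.tendsto 0
      simp only [Complex.ofReal_zero, mul_zero, Complex.exp_zero] at this
      exact this.mono_left nhdsWithin_le_nhds
    simpa using h1.smul (hT.tendsto_zero x)

theorem exists_bound_near_zero [CompleteSpace X] (hT : IsC0Semigroup T) :
    ∃ δ > 0, ∃ M, ∀ s, 0 ≤ s → s ≤ δ → ‖T s‖ ≤ M := by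
  by_contra! hcon
  -- The maximum with `‖T 0‖` excludes the time 0, since strong convergence is only given along
  -- positive times.
  have hex : ∀ n : ℕ, ∃ s, 0 ≤ s ∧ s ≤ 1 / ((n : ℝ) + 1) ∧ max (n : ℝ) ‖T 0‖ < ‖T s‖ := fun n =>
    hcon _ Nat.one_div_pos_of_nat _
  choose u hu0 hu1 hu2 using hex
  have hpos : ∀ n, 0 < u n := fun n => by
    refine (hu0 n).lt_of_ne fun h => ?_
    have := hu2 n
    rw [← h] at this
    exact absurd ((le_max_right _ _).trans_lt this) (lt_irrefl _)
  have hlim : Tendsto u atTop (𝓝[>] 0) := by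
    refine tendsto_nhdsWithin_iff.2 ⟨?_, Eventually.of_forall hpos⟩
    exact squeeze_zero hu0 hu1 tendsto_one_div_add_atTop_nhds_zero_nat
  obtain ⟨C, hC⟩ := banach_steinhaus (g := fun n => T (u n)) fun x => by
    obtain ⟨C, hC⟩ := ((hT.tendsto_zero x).comp hlim).norm.bddAbove_range
    exact ⟨C, fun n => hC ⟨n, rfl⟩⟩
  obtain ⟨n, hn⟩ := exists_nat_gt C
  exact absurd (hC n) (not_le.2 (hn.trans ((le_max_left _ _).trans_lt (hu2 n))))

theorem exists_bound [CompleteSpace X] (hT : IsC0Semigroup T) (t : ℝ) :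
    ∃ M, 0 ≤ M ∧ ∀ s, 0 ≤ s → s ≤ t → ‖T s‖ ≤ M := by
  obtain ⟨δ, hδ, M, hM⟩ := hT.exists_bound_near_zero
  have key : ∀ n : ℕ, ∃ C, 0 ≤ C ∧ ∀ s, 0 ≤ s → s ≤ n * δ → ‖T s‖ ≤ C := by
    intro n
    induction n with
    | zero =>
      refine ⟨‖T 0‖, norm_nonneg _, fun s h0 h1 => ?_⟩
      rw [le_antisymm (by simpa using h1) h0]
    | succ n ih =>
      obtain ⟨C, hC0, hC⟩ := ih
      have hM0 : 0 ≤ M := (norm_nonneg _).trans (hM 0 le_rfl hδ.le)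
      refine ⟨max M (M * C), le_max_of_le_left hM0, fun s h0 h1 => ?_⟩
      rcases le_total s δ with h | h
      · exact (hM s h0 h).trans (le_max_left _ _)
      · have hs : s = δ + (s - δ) := by ring
        rw [hs, hT.map_add _ _ hδ.le (sub_nonneg.2 h)]
        refine (ContinuousLinearMap.opNorm_comp_le _ _).trans (le_max_of_le_right ?_)
        refine mul_le_mul (hM δ hδ.le le_rfl) (hC _ (sub_nonneg.2 h) ?_) (norm_nonneg _) hM0
        push_cast at h1
        linarith
  obtain ⟨n, hn⟩ := exists_nat_gt (t / δ)
  obtain ⟨C, hC0, hC⟩ := key n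
  exact ⟨C, hC0, fun s h0 h1 => hC s h0 (h1.trans ((div_lt_iff₀ hδ).1 hn).le)⟩

theorem norm_sub_le_of_bound (hT : IsC0Semigroup T) {t M : ℝ}
    (hM : ∀ s, 0 ≤ s → s ≤ t → ‖T s‖ ≤ M) {r s : ℝ} (hr : 0 ≤ r) (hrs : r ≤ s) (hs : s ≤ t) (x : X) :
    ‖T s x - T r x‖ ≤ M * ‖T (s - r) x - x‖ := by
  have h : T s x = T r (T (s - r) x) := by
    rw [← hT.apply_add hr (sub_nonneg.2 hrs), add_sub_cancel]
  rw [h, ← _root_.map_sub]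
  exact (T r).le_of_opNorm_le (hM r hr (hrs.trans hs)) _

theorem continuousOn_Ici [CompleteSpace X] (hT : IsC0Semigroup T) (x : X) :
    ContinuousOn (fun s => T s x) (Set.Ici 0) := by
  intro s hs
  have hs0 : (0 : ℝ) ≤ s := hs
  obtain ⟨M, hM0, hM⟩ := hT.exists_bound (s + 1)
  have habs : Tendsto (fun r => |r - s|) (𝓝[Set.Ici 0] s) (𝓝 0) := by
    have h : Continuous fun r : ℝ => |r - s| := by fun_prop
    have := h.tendsto s
    simp only [sub_self, abs_zero] at this
    exact this.mono_left nhdsWithin_le_nhds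
  have h0 : Tendsto (fun h => T h x - x) (𝓝[≥] 0) (𝓝 0) := by
    rw [← Set.Ioi_insert, nhdsWithin_insert, tendsto_sup]
    constructor
    · rw [tendsto_pure_left]
      intro U hU
      simpa [hT.apply_zero] using mem_of_mem_nhds hU
    · simpa using (hT.tendsto_zero x).sub_const x
  have habs' : Tendsto (fun r => |r - s|) (𝓝[Set.Ici 0] s) (𝓝[≥] 0) :=
    tendsto_nhdsWithin_iff.2 ⟨habs, Eventually.of_forall fun r => Set.mem_Ici.2 (abs_nonneg _)⟩
  have hlim : Tendsto (fun r => M * ‖T |r - s| x - x‖) (𝓝[Set.Ici 0] s) (𝓝 0) := by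
    simpa using (h0.comp habs').norm.const_mul M
  rw [ContinuousWithinAt, tendsto_iff_norm_sub_tendsto_zero]
  refine squeeze_zero' (Eventually.of_forall fun _ => norm_nonneg _) ?_ hlim
  have hlt : ∀ᶠ r in 𝓝[Set.Ici 0] s, r < s + 1 :=
    nhdsWithin_le_nhds (Iio_mem_nhds (lt_add_one s))
  filter_upwards [self_mem_nhdsWithin, hlt] with r hr hr1
  rcases le_total r s with h | h
  · rw [norm_sub_rev, abs_sub_comm, abs_of_nonneg (sub_nonneg.2 h)]
    exact hT.norm_sub_le_of_bound hM hr h (by linarith) x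
  · rw [abs_of_nonneg (sub_nonneg.2 h)]
    exact hT.norm_sub_le_of_bound hM hs0 h hr1.le x

theorem intervalIntegrable [CompleteSpace X] (hT : IsC0Semigroup T) (x : X) {a b : ℝ}
    (ha : 0 ≤ a) (hb : 0 ≤ b) :
    IntervalIntegrable (fun s => T s x) MeasureTheory.volume a b :=
  ((hT.continuousOn_Ici x).mono fun _ hs => (le_min ha hb).trans hs.1).intervalIntegrable

end IsC0Semigroup

/-- The operator `x ↦ ∫₀ᵗ T(s) x ds`. -/
noncomputable def integralOperator [CompleteSpace X] (hT : IsC0Semigroup T) {t : ℝ} (ht : 0 ≤ t) :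
    X →L[ℂ] X :=
  LinearMap.mkContinuousOfExistsBound
    { toFun := fun x => ∫ s in (0 : ℝ)..t, T s x
      map_add' := fun x y => by
        simp only [_root_.map_add]
        exact intervalIntegral.integral_add (hT.intervalIntegrable x le_rfl ht)
          (hT.intervalIntegrable y le_rfl ht)
      map_smul' := fun c x => by
        simp only [_root_.map_smul, RingHom.id_apply]
        exact intervalIntegral.integral_smul c _ }
    (by
      obtain ⟨M, hM0, hM⟩ := hT.exists_bound t
      refine ⟨M * |t - 0|, fun x => ?_⟩
      refine (intervalIntegral.norm_integral_le_of_norm_le_const (C := M * ‖x‖) ?_).trans_eq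
        (by ring)
      intro s hs
      rw [Set.uIoc_of_le ht] at hs
      exact (T s).le_of_opNorm_le (hM s hs.1.le hs.2) x)

theorem integralOperator_apply [CompleteSpace X] (hT : IsC0Semigroup T) {t : ℝ} (ht : 0 ≤ t)
    (x : X) : integralOperator hT ht x = ∫ s in (0 : ℝ)..t, T s x := rfl

theorem commute_integralOperator [CompleteSpace X] (hT : IsC0Semigroup T) {t : ℝ} (ht : 0 ≤ t)
    {D : X →L[ℂ] X} (hD : ∀ s, 0 ≤ s → Commute D (T s)) : Commute D (integralOperator hT ht) := by
  ext x
  change D (∫ s in (0 : ℝ)..t, T s x) = ∫ s in (0 : ℝ)..t, T s (D x)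
  rw [← ContinuousLinearMap.intervalIntegral_comp_comm D (hT.intervalIntegrable x le_rfl ht)]
  refine intervalIntegral.integral_congr fun s hs => ?_
  rw [Set.uIcc_of_le ht] at hs
  exact congrArg (fun f : X →L[ℂ] X => f x) (hD s hs.1).eq

/-- The increment T(h)∫₀ᵗ - ∫₀ᵗ equals ∫ₜ^{t+h} - ∫₀ʰ; divide by h and use right continuity at t and
0. -/
theorem hasGeneratorValue_integralOperator [CompleteSpace X] (hT : IsC0Semigroup T) {t : ℝ}
    (ht : 0 ≤ t) (x : X) : HasGeneratorValue T (integralOperator hT ht x) (T t x - x) := by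
  have hquot : ∀ a, 0 ≤ a → Tendsto (fun h : ℝ => h⁻¹ • ∫ s in a..(a + h), T s x) (𝓝[>] 0)
      (𝓝 (T a x)) := by
    intro a ha
    have hd : HasDerivWithinAt (fun u => ∫ s in a..u, T s x) (T a x) (Set.Ici a) a := by
      refine intervalIntegral.integral_hasDerivWithinAt_right (t := Set.Ioi a)
        (hT.intervalIntegrable x ha ha) ?_ ?_
      · exact ((hT.continuousOn_Ici x).mono fun s hs => ha.trans (le_of_lt hs))
          |>.stronglyMeasurableAtFilter_nhdsWithin measurableSet_Ioi a
      · exact ((hT.continuousOn_Ici x) a ha).mono fun s hs => ha.trans (le_of_lt hs)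
    have h1 := (hd.mono Set.Ioi_subset_Ici_self)
    rw [hasDerivWithinAt_iff_tendsto_slope' (by simp)] at h1
    have h2 : Tendsto (fun h : ℝ => a + h) (𝓝[>] 0) (𝓝[>] a) := by
      refine tendsto_nhdsWithin_iff.2 ⟨?_, ?_⟩
      · have h : Continuous fun h : ℝ => a + h := by fun_prop
        have := h.tendsto 0
        rw [add_zero] at this
        exact this.mono_left nhdsWithin_le_nhds
      · filter_upwards [self_mem_nhdsWithin] with h hh
        exact lt_add_of_pos_right a hh
    refine (h1.comp h2).congr fun h => ?_
    simp [slope]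
  have hlim := (hquot t ht).sub (hquot 0 le_rfl)
  rw [hT.apply_zero] at hlim
  refine hlim.congr' ?_
  filter_upwards [self_mem_nhdsWithin] with h hh
  have hh0 : (0 : ℝ) < h := hh
  have hI : ∀ a b : ℝ, 0 ≤ a → 0 ≤ b →
      IntervalIntegrable (fun s => T s x) MeasureTheory.volume a b :=
    fun a b => hT.intervalIntegrable x
  have hshift : T h (integralOperator hT ht x) = ∫ s in h..(t + h), T s x := by
    rw [integralOperator_apply,
      ← ContinuousLinearMap.intervalIntegral_comp_comm _ (hI 0 t le_rfl ht)]
    have : (∫ s in h..(t + h), T s x) = ∫ s in (0 : ℝ)..t, T (s + h) x := by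
      rw [intervalIntegral.integral_comp_add_right (fun s => T s x), zero_add]
    rw [this]
    refine intervalIntegral.integral_congr fun s hs => ?_
    rw [Set.uIcc_of_le ht] at hs
    change T h (T s x) = T (s + h) x
    rw [← hT.apply_add hh0.le hs.1, add_comm]
  rw [hshift, integralOperator_apply, ← smul_sub]
  have hcast : ∀ y : X, ((h : ℂ)⁻¹) • y = h⁻¹ • y := fun y => by
    rw [← Complex.ofReal_inv, Complex.coe_smul]
  rw [hcast, zero_add]
  congr 1
  have e1 := intervalIntegral.integral_add_adjacent_intervals (hI 0 h le_rfl hh0.le)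
    (hI h (t + h) hh0.le (by positivity))
  have e2 := intervalIntegral.integral_add_adjacent_intervals (hI 0 t le_rfl ht)
    (hI t (t + h) ht (by positivity))
  rw [sub_eq_sub_iff_add_eq_add, add_comm, e2, ← e1, add_comm]

theorem HasGeneratorValue.map_of_commute {D : X →L[ℂ] X} (hD : ∀ s, 0 ≤ s → Commute D (T s))
    {x y : X} (h : HasGeneratorValue T x y) : HasGeneratorValue T (D x) (D y) := by
  refine ((D.continuous.tendsto y).comp h).congr' ?_
  filter_upwards [self_mem_nhdsWithin] with s hs
  have hc : D (T s x) = T s (D x) :=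
    congrArg (fun f : X →L[ℂ] X => f x) (hD s (le_of_lt hs)).eq
  simp [hc]

theorem HasGeneratorValue.integralOperator_apply [CompleteSpace X] (hT : IsC0Semigroup T) {t : ℝ}
    (ht : 0 ≤ t) {x y : X} (h : HasGeneratorValue T x y) :
    integralOperator hT ht y = T t x - x := by
  have hc : ∀ s, 0 ≤ s → Commute (integralOperator hT ht) (T s) := fun s hs =>
    (commute_integralOperator hT ht fun r hr => hT.commute hs hr).symm
  exact (h.map_of_commute hc).unique (hasGeneratorValue_integralOperator hT ht x)

/-- Product rule: the rescaled semigroup is generated by A - z. -/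
theorem HasGeneratorValue.rescale {x y : X} (h : HasGeneratorValue T x y) (z : ℂ) :
    HasGeneratorValue (fun s : ℝ => Complex.exp (-z * s) • T s) x (y - z • x) := by
  have hd : HasDerivAt (fun s : ℝ => Complex.exp (-z * s)) (-z) 0 := by
    have h1 : HasDerivAt (fun s : ℝ => -z * (s : ℂ)) (-z) 0 := by
      simpa using (Complex.ofRealCLM.hasDerivAt (x := (0 : ℝ))).const_mul (-z)
    simpa using h1.cexp
  have hslope := hd.tendsto_slope_zero_right
  simp only [zero_add, Complex.ofReal_zero, mul_zero, Complex.exp_zero] at hslope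
  have hexp : Tendsto (fun s : ℝ => Complex.exp (-z * s)) (𝓝[>] 0) (𝓝 1) := by
    have h : Continuous fun s : ℝ => Complex.exp (-z * s) := by fun_prop
    have := h.tendsto 0
    simp only [Complex.ofReal_zero, mul_zero, Complex.exp_zero] at this
    exact this.mono_left nhdsWithin_le_nhds
  have hlim := (hexp.smul h).add (hslope.smul_const x)
  rw [one_smul, neg_smul, ← sub_eq_add_neg] at hlim
  refine hlim.congr fun s => ?_
  have hcast : ∀ c : ℂ, s⁻¹ • c = (s : ℂ)⁻¹ * c := fun c => by
    rw [← Complex.ofReal_inv, Complex.real_smul]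
  rw [hcast, _root_.smul_apply, smul_comm, ← smul_smul, ← smul_add]
  congr 1
  rw [smul_sub, sub_smul, one_smul]
  abel

theorem HasGeneratorValue.of_rescale {x y : X} {z : ℂ}
    (h : HasGeneratorValue (fun s : ℝ => Complex.exp (-z * s) • T s) x y) :
    HasGeneratorValue T x (y + z • x) := by
  have h1 := h.rescale (-z)
  simp only [smul_smul, ← Complex.exp_add, neg_smul, sub_neg_eq_add] at h1
  simpa using h1

theorem hasGeneratorValue_generator (x : (generator T).domain) :
    HasGeneratorValue T x (generator T x) := x.2.choose_spec

end Semigroups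

/-! ### Factorization in a commutative Banach algebra -/

section BanachAlgebras

open WeakDual

variable {A : Type*} [NormedCommRing A] [NormedAlgebra ℂ A]

/-- An element with pairwise coprime divisors is the product of these divisors and a unit, if every
character that kills it kills one of the divisors but not the corresponding cofactor. -/
theorem exists_isUnit_eq_prod_mul [CompleteSpace A] {ι : Type*} [DecidableEq ι] {s : Finset ι} (hs : s.Nonempty)
    {q w : ι → A} {a : A} (h : ∀ i ∈ s, q i * w i = a)
    (hcop : Pairwise (Function.onFun IsCoprime fun i : s => q i))
    (hzero : ∀ φ : characterSpace ℂ A, φ a = 0 → ∃ i ∈ s, φ (q i) = 0)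
    (hsimple : ∀ φ : characterSpace ℂ A, ∀ i ∈ s, φ (q i) = 0 → φ (w i) ≠ 0) :
    ∃ v, IsUnit v ∧ a = (∏ i ∈ s, q i) * v := by
  -- Bézout for the products omitting one factor; multiplied by `a`, it exhibits ∑ cᵢ wᵢ as the
  -- complementary factor, to be shown invertible.
  obtain ⟨c, hc⟩ := (exists_sum_eq_one_iff_pairwise_coprime hs).2 hcop
  have hv : a = (∏ i ∈ s, q i) * ∑ i ∈ s, c i * w i := by
    calc a = a * ∑ i ∈ s, c i * ∏ j ∈ s \ {i}, q j := by rw [hc, mul_one]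
      _ = _ := by
        rw [Finset.mul_sum, Finset.mul_sum]
        refine Finset.sum_congr rfl fun i hi => ?_
        rw [← h i hi, Finset.sdiff_singleton_eq_erase, ← Finset.mul_prod_erase s q hi]
        ring
  refine ⟨∑ i ∈ s, c i * w i, ?_, hv⟩
  by_contra hunit
  obtain ⟨φ, hφ⟩ := CharacterSpace.exists_apply_eq_zero hunit
  have ha : φ a = 0 := by rw [hv, map_mul, hφ, mul_zero]
  obtain ⟨i, hi, hqi⟩ := hzero φ ha
  have hprod : ∀ j ∈ s, j ≠ i → φ (c j * ∏ k ∈ s \ {j}, q k) = 0 := fun j _ hji => by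
    rw [map_mul, map_prod, Finset.prod_eq_zero (i := i) (by simp [hi, hji.symm]) hqi, mul_zero]
  have h1 := congrArg φ hc
  rw [map_sum, map_one, Finset.sum_eq_single_of_mem i hi hprod, map_mul, map_prod] at h1
  have hci : φ (c i) ≠ 0 := left_ne_zero_of_mul (h1 ▸ one_ne_zero)
  have hqj : ∀ j ∈ s, j ≠ i → φ (q j) ≠ 0 := fun j hj hji =>
    Finset.prod_ne_zero_iff.1 (right_ne_zero_of_mul (h1 ▸ one_ne_zero)) j (by simp [hj, hji])
  -- Only the i-th term of the sum can survive under φ, and it is nonzero because φ kills `q i`.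
  have hwj : ∀ j ∈ s, j ≠ i → φ (c j * w j) = 0 := fun j hj hji => by
    have : φ (q j) * φ (w j) = 0 := by rw [← map_mul, h j hj, ha]
    rw [map_mul, (mul_eq_zero.1 this).resolve_left (hqj j hj hji), mul_zero]
  rw [map_sum, Finset.sum_eq_single_of_mem i hi hwj, map_mul] at hφ
  exact (mul_ne_zero hci (hsimple φ i hi hqi)) hφ

theorem finite_exp_eq_inter_ball {t : ℝ} (ht : 0 < t) (ν c : ℂ) (B : ℝ) :
    {z : ℂ | Complex.exp (z * t) = ν ∧ ‖c - z‖ ≤ B}.Finite := by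
  rcases Set.eq_empty_or_nonempty {z : ℂ | Complex.exp (z * t) = ν ∧ ‖c - z‖ ≤ B} with h | h
  · rw [h]
    exact Set.finite_empty
  obtain ⟨z₀, h0, hB0⟩ := h
  have htc : (t : ℂ) ≠ 0 := by exact_mod_cast ht.ne'
  refine ((Set.finite_Icc (-⌈2 * B * t⌉) ⌈2 * B * t⌉).image
    fun k : ℤ => z₀ + k * (2 * Real.pi * Complex.I) / t).subset ?_
  rintro z ⟨hz, hB⟩
  obtain ⟨k, hk⟩ := Complex.exp_eq_exp_iff_exists_int.1 (hz.trans h0.symm)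
  have hz' : z - z₀ = k * (2 * Real.pi * Complex.I) / t := by
    rw [eq_div_iff htc, sub_mul, hk, add_sub_cancel_left]
  refine ⟨k, ?_, add_eq_of_eq_sub' hz'.symm⟩
  have hnorm : |(k : ℝ)| ≤ 2 * B * t := by
    have h1 : ‖z - z₀‖ ≤ 2 * B := by
      calc ‖z - z₀‖ = ‖(c - z₀) - (c - z)‖ := by congr 1; ring
        _ ≤ ‖c - z₀‖ + ‖c - z‖ := norm_sub_le _ _
        _ ≤ 2 * B := by linarith
    have h2 : ‖z - z₀‖ * t = |(k : ℝ)| * (2 * Real.pi) := by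
      rw [hz', norm_div, norm_mul, norm_mul, norm_mul]
      simp [abs_of_pos ht, abs_of_pos Real.pi_pos, ht.ne']
    nlinarith [abs_nonneg (k : ℝ), Real.pi_gt_three]
  have hle := abs_le.1 hnorm
  constructor
  · have : -(k : ℝ) ≤ ⌈2 * B * t⌉ := by linarith [Int.le_ceil (2 * B * t)]
    have h3 : -k ≤ ⌈2 * B * t⌉ := by exact_mod_cast this
    linarith
  · have : (k : ℝ) ≤ ⌈2 * B * t⌉ := hle.2.trans (Int.le_ceil _)
    exact_mod_cast this

variable {r τ : A} {μ : ℂ} {t : ℝ} {y : ℂ → A}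

/-- Two affine polynomials in `r` with constant term -1 and different slopes have a scalar
combination equal to 1. -/
theorem isCoprime_of_ne {z z' : ℂ} (h : z ≠ z') :
    IsCoprime ((μ - z) • r - 1) ((μ - z') • r - 1) := by
  refine ⟨algebraMap ℂ A ((μ - z') / (z' - z)), algebraMap ℂ A (-(μ - z) / (z' - z)), ?_⟩
  have hne : z' - z ≠ 0 := sub_ne_zero.2 h.symm
  simp only [← Algebra.smul_def, smul_sub, smul_smul]
  have h1 : (μ - z') / (z' - z) * (μ - z) + -(μ - z) / (z' - z) * (μ - z') = 0 := by ring
  have h2 : -((μ - z') / (z' - z)) - -(μ - z) / (z' - z) = 1 := by field_simp; ring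
  calc _ = ((μ - z') / (z' - z) * (μ - z) + -(μ - z) / (z' - z) * (μ - z')) • r +
        (-((μ - z') / (z' - z)) - -(μ - z) / (z' - z)) • (1 : A) := by module
    _ = 1 := by rw [h1, h2, zero_smul, zero_add, one_smul]

theorem exp_eq_of_character (hq : ∀ z, ((μ - z) • r - 1) * y z = Complex.exp (-z * t) • τ - 1)
    (φ : characterSpace ℂ A) {z : ℂ} (hz : φ ((μ - z) • r - 1) = 0) :
    φ τ = Complex.exp (z * t) := by
  have h := congrArg φ (hq z)
  rw [map_mul, hz, zero_mul, map_sub, map_smul, map_one, smul_eq_mul] at h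
  have h1 : Complex.exp (z * t) * Complex.exp (-z * t) = 1 := by
    rw [← Complex.exp_add]
    simp
  calc φ τ = (Complex.exp (z * t) * Complex.exp (-z * t)) * φ τ := by rw [h1, one_mul]
    _ = Complex.exp (z * t) := by rw [mul_assoc, sub_eq_zero.1 h.symm, mul_one]

/-- Under φ the identity reads (z - z') φ(r) φ(y z') = e^{(z-z')t} - 1. Dividing by z - z' and
letting z' → z gives φ(r) φ(y z) = t ≠ 0. -/
theorem character_cofactor_ne_zero (ht : t ≠ 0) (hy : Continuous y)
    (hq : ∀ z, ((μ - z) • r - 1) * y z = Complex.exp (-z * t) • τ - 1)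
    (φ : characterSpace ℂ A) {z : ℂ} (hz : φ ((μ - z) • r - 1) = 0) : φ (y z) ≠ 0 := by
  have hτ := exp_eq_of_character hq φ hz
  have hr : (μ - z) * φ r = 1 := by
    rw [map_sub, map_smul, map_one, smul_eq_mul] at hz
    exact sub_eq_zero.1 hz
  have hfun : ∀ z', (z - z') * φ r * φ (y z') = Complex.exp ((z - z') * t) - 1 := by
    intro z'
    have h := congrArg φ (hq z')
    rw [map_mul, map_sub, map_smul, map_sub, map_smul, map_one, smul_eq_mul, smul_eq_mul, hτ,
      ← Complex.exp_add] at h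
    have e : -z' * (t : ℂ) + z * t = (z - z') * t := by ring
    rw [e] at h
    rw [← h]
    linear_combination -φ (y z') * hr
  have hd : HasDerivAt (fun z' : ℂ => Complex.exp ((z - z') * t) - 1) (-(t : ℂ)) z := by
    have h1 : HasDerivAt (fun z' : ℂ => (z - z') * (t : ℂ)) (-(t : ℂ)) z := by
      simpa using ((hasDerivAt_id z).const_sub z).mul_const (t : ℂ)
    simpa using h1.cexp.sub_const 1
  have hslope := hasDerivAt_iff_tendsto_slope.1 hd
  have hcont : Tendsto (fun z' => -(φ r * φ (y z'))) (𝓝[≠] z) (𝓝 (-(φ r * φ (y z)))) := by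
    have hc : Continuous fun z' => φ (y z') := (map_continuous φ).comp hy
    exact ((hc.const_mul (φ r)).neg.tendsto z).mono_left nhdsWithin_le_nhds
  have heq : slope (fun z' : ℂ => Complex.exp ((z - z') * t) - 1) z =ᶠ[𝓝[≠] z]
      fun z' => -(φ r * φ (y z')) := by
    filter_upwards [self_mem_nhdsWithin] with z' hz'
    have hne : z' - z ≠ 0 := sub_ne_zero.2 hz'
    rw [slope_def_field, ← hfun, ← hfun]
    field_simp
    ring
  have hlim := tendsto_nhds_unique (hslope.congr' heq) hcont
  intro h0
  rw [h0, mul_zero, neg_zero, neg_eq_zero] at hlim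
  exact ht (by exact_mod_cast hlim)

/-- If `r` plays the role of the resolvent at `μ` and `τ` that of the operator `T(t)`, of which some
power factors through `r`, then `τ - ν` is up to a unit a finite product of elements
`(μ - z) r - 1` with `e^{z t} = ν`. -/
theorem exists_finset_factorization [CompleteSpace A] (ht : 0 < t) (hy : Continuous y)
    (hq : ∀ z, ((μ - z) • r - 1) * y z = Complex.exp (-z * t) • τ - 1)
    {j : A} {n : ℕ} (hj : r * j = τ ^ n) {ν : ℂ} (hν : ν ≠ 0) :
    ∃ s : Finset ℂ, (∀ z ∈ s, Complex.exp (z * t) = ν) ∧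
      ∃ v, IsUnit v ∧ τ - ν • 1 = (∏ z ∈ s, ((μ - z) • r - 1)) * v := by
  have htc : (t : ℂ) ≠ 0 := by exact_mod_cast ht.ne'
  -- This bounds |μ - z| = 1/|φ(r)| = |φ(j)|/|ν|ⁿ for every relevant character φ.
  set B : ℝ := ‖j‖ * ‖(1 : A)‖ / ‖ν‖ ^ n
  have hfin := finite_exp_eq_inter_ball ht ν μ B
  -- The logarithm only serves to make `s` nonempty, as the Bézout identity requires.
  set s : Finset ℂ := insert (Complex.log ν / t) hfin.toFinset with hs
  have hsν : ∀ z ∈ s, Complex.exp (z * t) = ν := by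
    intro z hz
    rcases Finset.mem_insert.1 hz with rfl | hz
    · rw [div_mul_cancel₀ _ htc, Complex.exp_log hν]
    · exact (hfin.mem_toFinset.1 hz).1
  refine ⟨s, hsν, ?_⟩
  have hmul : ∀ z ∈ s, ((μ - z) • r - 1) * (Complex.exp (z * t) • y z) = τ - ν • 1 := by
    intro z hz
    rw [mul_smul_comm, hq, smul_sub, smul_smul, ← Complex.exp_add, hsν z hz]
    simp
  refine exists_isUnit_eq_prod_mul (w := fun z => Complex.exp (z * t) • y z)
    ⟨_, Finset.mem_insert_self _ _⟩ hmul ?_ ?_ ?_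
  · exact fun z z' hzz' => isCoprime_of_ne fun h => hzz' (Subtype.ext h)
  · intro φ hφ
    have hτ : φ τ = ν := by
      rw [map_sub, map_smul, map_one, smul_eq_mul, mul_one] at hφ
      exact sub_eq_zero.1 hφ
    have hrj : φ r * φ j = ν ^ n := by rw [← map_mul, hj, map_pow, hτ]
    have hr : φ r ≠ 0 := left_ne_zero_of_mul (hrj ▸ pow_ne_zero n hν)
    have hz : φ ((μ - (μ - (φ r)⁻¹)) • r - 1) = 0 := by
      rw [map_sub, map_smul, map_one, smul_eq_mul, sub_sub_cancel, inv_mul_cancel₀ hr, sub_self]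
    refine ⟨μ - (φ r)⁻¹, Finset.mem_insert_of_mem (hfin.mem_toFinset.2 ⟨?_, ?_⟩), hz⟩
    · rw [← exp_eq_of_character hq φ hz, hτ]
    · have hinv : (φ r)⁻¹ = φ j / ν ^ n := by
        rw [← hrj]
        have hj0 : φ j ≠ 0 := right_ne_zero_of_mul (hrj ▸ pow_ne_zero n hν)
        field_simp
      rw [sub_sub_cancel, hinv, norm_div, norm_pow]
      exact div_le_div_of_nonneg_right (AlgHom.norm_apply_le_self_mul_norm_one φ j) (by positivity)
  · intro φ z _ hz
    rw [map_smul, smul_eq_mul]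
    exact mul_ne_zero (Complex.exp_ne_zero _) (character_cofactor_ne_zero ht.ne' hy hq φ hz)

end BanachAlgebras

/-! ### Resolvent, cofactors and the spectral mapping theorem -/

section SpectralMapping

variable {X : Type*} [NormedAddCommGroup X] [NormedSpace ℂ X] {T : ℝ → X →L[ℂ] X}

/-- `R = (μ - A)⁻¹` for the generator `A` of `T`. -/
structure IsResolvent (T : ℝ → X →L[ℂ] X) (μ : ℂ) (R : X →L[ℂ] X) : Prop where
  hasGeneratorValue : ∀ y, HasGeneratorValue T (R y) (μ • R y - y)
  apply_sub : ∀ x z, HasGeneratorValue T x z → R (μ • x - z) = x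
  commute : ∀ D : X →L[ℂ] X, (∀ s, 0 ≤ s → Commute D (T s)) → Commute D R

/-- With μ = ‖T(1)‖ the rescaled semigroup S has ‖S(1)‖ ≤ μe^{-μ} < 1. Since (A - μ)∫₀¹ S = S(1) -
1, the resolvent is ∫₀¹ S times (1 - S(1))⁻¹; no improper integral is needed. -/
theorem exists_isResolvent [CompleteSpace X] (hT : IsC0Semigroup T) :
    ∃ (μ : ℂ) (R : X →L[ℂ] X), IsResolvent T μ R := by
  set μ : ℂ := (‖T 1‖ : ℂ) with hμ
  set S : ℝ → X →L[ℂ] X := fun s => Complex.exp (-μ * s) • T s with hS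
  have hSC : IsC0Semigroup S := hT.rescale μ
  have hnorm : ‖S 1‖ < 1 := by
    have h1 : ‖Complex.exp (-μ * (1 : ℝ))‖ = Real.exp (-‖T 1‖) := by
      rw [Complex.norm_exp]
      simp [hμ]
    change ‖Complex.exp (-μ * (1 : ℝ)) • T 1‖ < 1
    rw [norm_smul, h1, Real.exp_neg, inv_mul_lt_iff₀ (Real.exp_pos _), mul_one]
    linarith [Real.add_one_le_exp ‖T 1‖]
  obtain ⟨u, hu⟩ := isUnit_one_sub_of_norm_lt_one hnorm
  set C := integralOperator hSC zero_le_one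
  have hcomm : ∀ D : X →L[ℂ] X, (∀ s, 0 ≤ s → Commute D (S s)) →
      Commute D C ∧ Commute D (↑u⁻¹ : X →L[ℂ] X) := fun D hD => by
    refine ⟨commute_integralOperator hSC zero_le_one hD, Commute.units_inv_right ?_⟩
    rw [hu]
    exact (Commute.one_right D).sub_right (hD 1 zero_le_one)
  have hCu : Commute C (↑u⁻¹ : X →L[ℂ] X) :=
    (hcomm C fun s hs => (commute_integralOperator hSC zero_le_one
      fun r hr => hSC.commute hs hr).symm).2
  have huinv : ∀ x, (u : X →L[ℂ] X) ((↑u⁻¹ : X →L[ℂ] X) x) = x := fun x =>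
    congrArg (fun f : X →L[ℂ] X => f x) u.mul_inv
  have hinvu : ∀ x, (↑u⁻¹ : X →L[ℂ] X) ((u : X →L[ℂ] X) x) = x := fun x =>
    congrArg (fun f : X →L[ℂ] X => f x) u.inv_mul
  have hux : ∀ x, (u : X →L[ℂ] X) x = x - S 1 x := fun x => by
    rw [hu]
    rfl
  refine ⟨μ, C * ↑u⁻¹, fun y => ?_, fun x z h => ?_, fun D hD => ?_⟩
  · have h := (hasGeneratorValue_integralOperator hSC zero_le_one
      ((↑u⁻¹ : X →L[ℂ] X) y)).of_rescale
    have e : S 1 ((↑u⁻¹ : X →L[ℂ] X) y) - (↑u⁻¹ : X →L[ℂ] X) y = -y := by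
      rw [← neg_sub, ← hux, huinv]
    rw [e, neg_add_eq_sub] at h
    exact h
  · have h1 : C (z - μ • x) = S 1 x - x :=
      HasGeneratorValue.integralOperator_apply hSC zero_le_one (h.rescale μ)
    rw [hCu.eq]
    change (↑u⁻¹ : X →L[ℂ] X) (C (μ • x - z)) = x
    rw [← neg_sub, _root_.map_neg, h1, neg_sub, ← hux, hinvu]
  · obtain ⟨h1, h2⟩ := hcomm D fun s hs => (hD s hs).smul_right _
    exact h1.mul_right h2

/-- The cofactor of `(μ - z) R - 1` in `e^{-z t} T(t) - 1`. -/
noncomputable def cofactor [CompleteSpace X] (hT : IsC0Semigroup T) {t : ℝ} (ht : 0 ≤ t)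
    (μ z : ℂ) : X →L[ℂ] X :=
  (μ - z) • integralOperator (hT.rescale z) ht - Complex.exp (-z * t) • T t + 1

/-- For c = ∫₀ᵗ e^{-zs}T(s)x ds the cofactor sends x to (μ - A)c, which R takes back to c. -/
theorem IsResolvent.mul_cofactor [CompleteSpace X] {μ : ℂ} {R : X →L[ℂ] X}
    (hR : IsResolvent T μ R) (hT : IsC0Semigroup T) {t : ℝ} (ht : 0 ≤ t) (z : ℂ) :
    ((μ - z) • R - 1) * cofactor hT ht μ z = Complex.exp (-z * t) • T t - 1 := by
  ext x
  set c := integralOperator (hT.rescale z) ht x with hc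
  have h1 := (hasGeneratorValue_integralOperator (hT.rescale z) ht x).of_rescale
  have h2 := hR.apply_sub _ _ h1
  have h3 : cofactor hT ht μ z x = μ • c - ((Complex.exp (-z * t) • T t) x - x + z • c) := by
    change (μ - z) • c - (Complex.exp (-z * t) • T t) x + x = _
    module
  change (μ - z) • R (cofactor hT ht μ z x) - cofactor hT ht μ z x =
    (Complex.exp (-z * t) • T t) x - x
  rw [h3, h2, ← hc]
  module

/-- Norm continuity follows from |e^{(z-z')s} - 1| ≤ 2|z - z'|t, uniformly for 0 < s ≤ t and z' near
z. -/
theorem continuous_integralOperator_rescale [CompleteSpace X] (hT : IsC0Semigroup T) {t : ℝ}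
    (ht : 0 ≤ t) : Continuous fun z : ℂ => integralOperator (hT.rescale z) ht := by
  obtain ⟨M, hM0, hM⟩ := hT.exists_bound t
  refine continuous_iff_continuousAt.2 fun z => ?_
  set K : ℝ := Real.exp (‖z‖ * t) * (2 * t) * M * t with hK
  have hlim : Tendsto (fun z' : ℂ => K * ‖z' - z‖) (𝓝 z) (𝓝 0) := by
    have h : Continuous fun z' : ℂ => K * ‖z' - z‖ := by fun_prop
    simpa using h.tendsto z
  have hsmall : ∀ᶠ z' in 𝓝 z, ‖z' - z‖ * t < 1 := by
    have h : Continuous fun z' : ℂ => ‖z' - z‖ * t := by fun_prop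
    have h0 : Tendsto (fun z' : ℂ => ‖z' - z‖ * t) (𝓝 z) (𝓝 0) := by simpa using h.tendsto z
    exact h0.eventually_lt_const one_pos
  rw [ContinuousAt, tendsto_iff_norm_sub_tendsto_zero]
  refine squeeze_zero' (Eventually.of_forall fun _ => norm_nonneg _) ?_ hlim
  filter_upwards [hsmall] with z' hz'
  refine ContinuousLinearMap.opNorm_le_bound _ (by positivity) fun x => ?_
  change ‖(∫ s in (0 : ℝ)..t, (Complex.exp (-z' * s) • T s) x) -
    ∫ s in (0 : ℝ)..t, (Complex.exp (-z * s) • T s) x‖ ≤ _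
  rw [← intervalIntegral.integral_sub ((hT.rescale z').intervalIntegrable x le_rfl ht)
    ((hT.rescale z).intervalIntegrable x le_rfl ht)]
  refine (intervalIntegral.norm_integral_le_of_norm_le_const
    (C := Real.exp (‖z‖ * t) * (2 * (‖z' - z‖ * t)) * (M * ‖x‖)) ?_).trans_eq ?_
  · intro s hs
    rw [Set.uIoc_of_le ht] at hs
    have hs0 : 0 ≤ s := hs.1.le
    have hzs : ‖(z - z') * s‖ ≤ ‖z' - z‖ * t := by
      rw [norm_mul, norm_sub_rev, Complex.norm_real, Real.norm_of_nonneg hs0]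
      exact mul_le_mul_of_nonneg_left hs.2 (norm_nonneg _)
    have h1 : ‖Complex.exp (-z * s)‖ ≤ Real.exp (‖z‖ * t) := by
      refine (Complex.norm_exp_le_exp_norm _).trans (Real.exp_le_exp.2 ?_)
      rw [norm_mul, norm_neg, Complex.norm_real, Real.norm_of_nonneg hs0]
      exact mul_le_mul_of_nonneg_left hs.2 (norm_nonneg _)
    have h2 : ‖Complex.exp ((z - z') * s) - 1‖ ≤ 2 * (‖z' - z‖ * t) :=
      (Complex.norm_exp_sub_one_le (hzs.trans hz'.le)).trans
        (mul_le_mul_of_nonneg_left hzs two_pos.le)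
    have h3 : (Complex.exp (-z' * s) • T s) x - (Complex.exp (-z * s) • T s) x =
        (Complex.exp (-z * s) * (Complex.exp ((z - z') * s) - 1)) • T s x := by
      rw [_root_.smul_apply, _root_.smul_apply, mul_sub, mul_one, ← Complex.exp_add, ← sub_smul]
      congr 3
      ring_nf
    rw [h3, norm_smul, norm_mul]
    exact mul_le_mul (mul_le_mul h1 h2 (norm_nonneg _) (Real.exp_pos _).le)
      ((T s).le_of_opNorm_le (hM s hs0 hs.2) x) (norm_nonneg _) (by positivity)
  · rw [sub_zero, abs_of_nonneg ht, hK]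
    ring

theorem continuous_cofactor [CompleteSpace X] (hT : IsC0Semigroup T) {t : ℝ} (ht : 0 ≤ t)
    (μ : ℂ) : Continuous (cofactor hT ht μ) := by
  have h := continuous_integralOperator_rescale hT ht
  unfold cofactor
  fun_prop

theorem commute_cofactor [CompleteSpace X] (hT : IsC0Semigroup T) {t : ℝ} (ht : 0 ≤ t)
    (μ z : ℂ) {D : X →L[ℂ] X} (hD : ∀ s, 0 ≤ s → Commute D (T s)) :
    Commute D (cofactor hT ht μ z) :=
  (((commute_integralOperator (hT.rescale z) ht fun s hs => (hD s hs).smul_right _).smul_right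
    _).sub_right ((hD t ht).smul_right _)).add_right (Commute.one_right D)

namespace IsResolvent

variable {μ : ℂ} {R : X →L[ℂ] X}

theorem injective (hR : IsResolvent T μ R) : Function.Injective R := by
  rw [injective_iff_map_eq_zero]
  intro y hy
  have h := hR.hasGeneratorValue y
  rw [hy, smul_zero, zero_sub] at h
  exact neg_eq_zero.1 (h.unique (HasGeneratorValue.zero T))

theorem isQuotientOf (hR : IsResolvent T μ R) (z : ℂ) :
    IsQuotientOf (shift (generator T) z) ((μ - z) • R - 1) R where
  injective := hR.injective
  commute := ((Commute.refl R).smul_left _).sub_left (Commute.one_left R)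
  domain_eq := by
    ext x
    constructor
    · rintro ⟨w, hw⟩
      exact ⟨μ • x - w, hR.apply_sub x w hw⟩
    · rintro ⟨y, rfl⟩
      exact ⟨_, hR.hasGeneratorValue y⟩
  apply_eq y h := by
    have h1 : generator T ⟨R y, h⟩ = μ • R y - y :=
      (hasGeneratorValue_generator ⟨R y, h⟩).unique (hR.hasGeneratorValue y)
    change generator T ⟨R y, h⟩ - z • R y = (μ - z) • R y - y
    rw [h1]
    module
  mem_range_of_apply y := by
    rintro ⟨w, hw⟩
    have hw' : R w = (μ - z) • R y - y := hw
    refine ⟨(μ - z) • y - w, ?_⟩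
    change R ((μ - z) • y - w) = y
    rw [_root_.map_sub, _root_.map_smul, hw', sub_sub_cancel]

/-- The factor is J = (μ - A)T(t₀), bounded exactly because AT(t₀) is. -/
theorem exists_mul_eq (hR : IsResolvent T μ R) {t₀ : ℝ}
    (h : ∀ x : X, T t₀ x ∈ (generator T).domain)
    (hC : ∃ C : ℝ, ∀ x : X, ‖generator T ⟨T t₀ x, h x⟩‖ ≤ C * ‖x‖) :
    ∃ J : X →L[ℂ] X, R * J = T t₀ := by
  obtain ⟨C, hC⟩ := hC
  let G : X →ₗ[ℂ] X :=
    (generator T).toFun.comp ((T t₀ : X →ₗ[ℂ] X).codRestrict (generator T).domain h)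
  refine ⟨μ • T t₀ - G.mkContinuous C hC, ?_⟩
  ext x
  exact hR.apply_sub _ _ (hasGeneratorValue_generator ⟨T t₀ x, h x⟩)

end IsResolvent

theorem IsC0Semigroup.pow_apply (hT : IsC0Semigroup T) {t : ℝ} (ht : 0 ≤ t) (n : ℕ) :
    T (n * t) = T t ^ n := by
  induction n with
  | zero =>
    rw [Nat.cast_zero, zero_mul, hT.map_zero, pow_zero]
    rfl
  | succ n ih =>
    rw [Nat.cast_succ, add_mul, one_mul, hT.map_add _ _ (by positivity) ht, ih, pow_succ]
    rfl

/-- The bicommutant of the semigroup. -/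
def bicommutant (T : ℝ → X →L[ℂ] X) : Subalgebra ℂ (X →L[ℂ] X) :=
  Subalgebra.centralizer ℂ (Set.centralizer (T '' Set.Ici 0))

theorem mem_bicommutant_iff {B : X →L[ℂ] X} :
    B ∈ bicommutant T ↔ ∀ D : X →L[ℂ] X, (∀ s, 0 ≤ s → Commute D (T s)) → Commute D B := by
  rw [bicommutant, Subalgebra.mem_centralizer_iff]
  refine forall_congr' fun D => imp_congr ?_ Iff.rfl
  rw [Set.mem_centralizer_iff, Set.forall_mem_image]
  exact ⟨fun h s hs => (h hs).symm, fun h s hs => (h s hs).symm⟩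

/-- The T(s) commute with each other, so the bicommutant lies in the commutant, with which each of
its elements commutes. -/
theorem IsC0Semigroup.bicommutant_mul_comm (hT : IsC0Semigroup T) (a b : bicommutant T) :
    a * b = b * a := by
  have ha : ∀ s, 0 ≤ s → Commute (a : X →L[ℂ] X) (T s) := fun s hs =>
    (mem_bicommutant_iff.1 a.2 (T s) fun r hr => hT.commute hs hr).symm
  exact Subtype.ext (mem_bicommutant_iff.1 b.2 a ha).eq

theorem isClosed_bicommutant : IsClosed (bicommutant T : Set (X →L[ℂ] X)) :=
  Set.isClosed_centralizer _

theorem IsRegularity.prod {P : (X →L[ℂ] X) → Prop} (hP : IsRegularity P) {A ι : Type*}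
    [CommSemiring A] (f : A →* (X →L[ℂ] X)) (s : Finset ι) (q : ι → A)
    (h : ∀ i ∈ s, P (f (q i))) : P (f (∏ i ∈ s, q i)) := by
  classical
  induction s using Finset.induction_on with
  | empty =>
    rw [Finset.prod_empty, _root_.map_one]
    exact hP.of_isUnit 1 isUnit_one
  | insert i s hi ih =>
    rw [Finset.prod_insert hi, _root_.map_mul]
    exact hP.mul _ _ ((Commute.all _ _).map f) (h i (Finset.mem_insert_self i s))
      (ih fun j hj => h j (Finset.mem_insert_of_mem hj))

theorem IsRegularity.semigroup_sub_of_forall [CompleteSpace X] {P : (X →L[ℂ] X) → Prop}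
    (hP : IsRegularity P) (hT : IsC0Semigroup T) {μ : ℂ} {R J : X →L[ℂ] X}
    (hR : IsResolvent T μ R) {t₀ : ℝ} (ht₀ : 0 ≤ t₀) (hJ : R * J = T t₀) {t : ℝ} (ht : 0 < t)
    {ν : ℂ} (hν : ν ≠ 0)
    (h : ∀ z, Complex.exp (z * t) = ν → P ((μ - z) • R - 1)) : P (T t - ν • 1) := by
  -- Once nt ≥ t₀, T(t)ⁿ = T(t₀)T(nt - t₀) is a multiple of R.
  obtain ⟨n, hn⟩ := exists_nat_ge (t₀ / t)
  have hr0 : 0 ≤ n * t - t₀ := sub_nonneg.2 ((div_le_iff₀ ht).1 hn)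
  have hJT : R * (J * T (n * t - t₀)) = T t ^ n := by
    rw [← mul_assoc, hJ, ← hT.pow_apply ht.le, ← add_sub_cancel t₀ (n * t), hT.map_add _ _ ht₀ hr0,
      add_sub_cancel]
    rfl
  have hRmem : R ∈ bicommutant T := mem_bicommutant_iff.2 hR.commute
  have hTmem : ∀ s, 0 ≤ s → T s ∈ bicommutant T := fun s hs =>
    mem_bicommutant_iff.2 fun D hD => hD s hs
  -- D commutes with R and with RJ = T(t₀); injectivity of R cancels R.
  have hJmem : J ∈ bicommutant T := mem_bicommutant_iff.2 fun D hD => by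
    have h1 : R * (D * J) = R * (J * D) := by
      rw [← mul_assoc, ← mul_assoc, hJ, ← (hR.commute D hD).eq, mul_assoc, hJ]
      exact (hD t₀ ht₀).eq
    ext x
    exact hR.injective (congrArg (fun f : X →L[ℂ] X => f x) h1)
  let _ : NormedCommRing (bicommutant T) :=
    { (inferInstance : NormedRing (bicommutant T)) with mul_comm := hT.bicommutant_mul_comm }
  let _ : NormedAlgebra ℂ (bicommutant T) := Subalgebra.toNormedAlgebra (bicommutant T)
  have : CompleteSpace (bicommutant T) := isClosed_bicommutant.completeSpace_coe
  obtain ⟨s, hs, v, hv, hprod⟩ := exists_finset_factorization (A := bicommutant T)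
    (r := ⟨R, hRmem⟩) (τ := ⟨T t, hTmem t ht.le⟩) (μ := μ) (t := t)
    (y := fun z => ⟨cofactor hT ht.le μ z,
      mem_bicommutant_iff.2 fun D hD => commute_cofactor hT ht.le μ z hD⟩) ht
    (continuous_induced_rng.2 (continuous_cofactor hT ht.le μ))
    (fun z => Subtype.ext (hR.mul_cofactor hT ht.le z))
    (j := ⟨J * T (n * t - t₀), (bicommutant T).mul_mem hJmem (hTmem _ hr0)⟩) (n := n)
    (Subtype.ext hJT) hν
  let f : bicommutant T →* (X →L[ℂ] X) := (bicommutant T).val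
  have e : T t - ν • 1 = f (∏ z ∈ s, ((μ - z) • (⟨R, hRmem⟩ : bicommutant T) - 1)) * f v := by
    rw [← _root_.map_mul, ← hprod]
    rfl
  rw [e]
  refine hP.mul _ _ ((Commute.all _ _).map f) ?_ (hP.of_isUnit _ (hv.map f))
  exact hP.prod f s _ fun z hz => h z (hs z hz)

theorem IsRegularity.of_semigroup_sub [CompleteSpace X] {P : (X →L[ℂ] X) → Prop}
    (hP : IsRegularity P) (hT : IsC0Semigroup T) {μ : ℂ} {R : X →L[ℂ] X}
    (hR : IsResolvent T μ R) {t : ℝ} (ht : 0 ≤ t) {z : ℂ}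
    (h : P (T t - Complex.exp (z * t) • 1)) : P ((μ - z) • R - 1) := by
  have hexp : Complex.exp (z * t) * Complex.exp (-z * t) = 1 := by
    rw [← Complex.exp_add]
    simp
  have e : ((μ - z) • R - 1) * (Complex.exp (z * t) • cofactor hT ht μ z) =
      T t - Complex.exp (z * t) • 1 := by
    rw [mul_smul_comm, hR.mul_cofactor hT ht z, smul_sub, smul_smul, hexp, one_smul]
  refine hP.of_mul _ (Complex.exp (z * t) • cofactor hT ht μ z) ?_ (e ▸ h)
  have hcomm : Commute (cofactor hT ht μ z) R := hR.commute _ fun s hs =>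
    (commute_cofactor hT ht μ z fun r hr => hT.commute hs hr).symm
  exact ((hcomm.symm.smul_left _).sub_left (Commute.one_left _)).smul_right _

/-- The spectral mapping theorem for the spectrum defined by a regularity. -/
theorem IsRegularity.spectrum_sdiff_eq [CompleteSpace X] {P : (X →L[ℂ] X) → Prop}
    (hP : IsRegularity P) {Q : (X →ₗ.[ℂ] X) → Prop}
    (hQ : ∀ L B R, IsQuotientOf L B R → (Q L ↔ P B)) (hT : IsC0Semigroup T)
    (hA : ∃ t₀ : ℝ, 0 < t₀ ∧ ∃ h : ∀ x : X, T t₀ x ∈ (generator T).domain,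
      ∃ C : ℝ, ∀ x : X, ‖generator T ⟨T t₀ x, h x⟩‖ ≤ C * ‖x‖)
    {t : ℝ} (ht : 0 < t) :
    {ν : ℂ | ¬ Q (shift (ofBounded (T t)) ν)} \ {0} =
      {ν : ℂ | ∃ z ∈ {z : ℂ | ¬ Q (shift (generator T) z)}, ν = Complex.exp (z * t)} := by
  obtain ⟨t₀, ht₀, hdom, hC⟩ := hA
  obtain ⟨μ, R, hR⟩ := exists_isResolvent hT
  obtain ⟨J, hJ⟩ := hR.exists_mul_eq hdom hC
  ext ν
  simp only [Set.mem_sdiff, Set.mem_ofPred_eq, Set.mem_singleton_iff,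
    hQ _ _ _ (IsQuotientOf.ofBounded_shift (T t) ν), hQ _ _ _ (hR.isQuotientOf _)]
  constructor
  · rintro ⟨h, hν⟩
    by_contra! hcon
    exact h (hP.semigroup_sub_of_forall hT hR ht₀.le hJ ht hν fun z hz =>
      not_not.1 fun hz' => hcon z hz' hz.symm)
  · rintro ⟨z, hz, rfl⟩
    exact ⟨fun h => hz (hP.of_semigroup_sub hT hR ht.le h), Complex.exp_ne_zero _⟩

end SpectralMapping

end C0Spectra

theorem mainTheorem2 {X : Type*} [NormedAddCommGroup X] [NormedSpace ℂ X] [CompleteSpace X]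
    (hX : C0Spectra.IsReflexive X)
    (T : ℝ → X →L[ℂ] X) (hT : C0Spectra.IsC0Semigroup T)
    (hA : ∃ t₀ : ℝ, 0 < t₀ ∧ ∃ h : ∀ x : X, T t₀ x ∈ (C0Spectra.generator T).domain,
      ∃ C : ℝ, ∀ x : X, ‖C0Spectra.generator T ⟨T t₀ x, h x⟩‖ ≤ C * ‖x‖)
    (t : ℝ) (ht : 0 < t) :
    C0Spectra.upperSemiBrowderSpectrum (C0Spectra.ofBounded (T t)) \ {0} =
        {μ : ℂ | ∃ z ∈ C0Spectra.upperSemiBrowderSpectrum (C0Spectra.generator T),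
          μ = Complex.exp (z * t)} ∧
      C0Spectra.lowerSemiBrowderSpectrum (C0Spectra.ofBounded (T t)) \ {0} =
        {μ : ℂ | ∃ z ∈ C0Spectra.lowerSemiBrowderSpectrum (C0Spectra.generator T),
          μ = Complex.exp (z * t)} ∧
      C0Spectra.browderSpectrum (C0Spectra.ofBounded (T t)) \ {0} =
        {μ : ℂ | ∃ z ∈ C0Spectra.browderSpectrum (C0Spectra.generator T),
          μ = Complex.exp (z * t)} := by
  open C0Spectra in
  exact ⟨isRegularity_upperBrowder.spectrum_sdiff_eq
      (fun _ _ _ h => h.isUpperSemiBrowder_iff) hT hA ht,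
    isRegularity_lowerBrowder.spectrum_sdiff_eq
      (fun _ _ _ h => h.isLowerSemiBrowder_iff) hT hA ht,
    (isRegularity_lowerBrowder.and isRegularity_upperBrowder).spectrum_sdiff_eq
      (fun _ _ _ h => h.isBrowder_iff) hT hA ht⟩
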